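/- For integers $q\ge 1$ and a finite set $\mathcal D$ of $k$ positive integers, all multiples of $q$, let $$\mathfrak S(\mathcal D;q)=\Big(\frac{\varphi(q)}{q}\Big)^{-k}\prod_{p\nmid q}\Big(1-\frac1p\Big)^{-k}\Big(1-\frac{v_p(\mathcal D)}{p}\Big),$$ where the product is over the primes $p$ not dividing $q$ and $v_p(\mathcal D)$ is the number of residue classes modulo $p$ that contain an element of $\mathcal D$. Assume the following uniform variant of the Hardy–Littlewood prime $k$-tuple conjecture: there is an absolute constant $0<\delta<1/2$ such that for all integers $k,q,N,D\ge 1$ and every set $\mathcal D\subseteq[1,D]$ consisting of $k$ distinct multiples of $q$, $$\sum_{\substack{1\le n\le N\\(n,q)=1}}\ \prod_{d\in\mathcal D}\Lambda(n+d)=\mathfrak S(\mathcal D;q)\,\big|\{1\le n\le N:(n,q)=1\}\big|+O_{k,\delta}\big((N+D)^{1-\delta}\big),$$ where $\Lambda$ is the von Mangoldt function and the implied constant depends on $k$ and $\delta$ only. Let $k\ge 0$ be a fixed integer and $\lambda>0$ a fixed real number. Let $N$ and $q$ run through sequences of non-negative integers with $N\to\infty$ and $\varphi(q)=(1+o(1))\dfrac{N}{\lambda\log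 N}$. Then $$\lim_{N\to\infty}\frac1{\varphi(q)}\,\big|\{a \bmod q:\ (a,q)=1,\ \pi(N;q,a)=k\}\big|=e^{-\lambda}\frac{\lambda^k}{k!},$$ where $\pi(N;q,a)$ is the number of primes $p\le N$ with $p\equiv a \pmod q$. -/

import Mathlib

open Filter Topology Asymptotics

noncomputable section

/-- The number `v_p(𝒟)` of residue classes modulo `p` that contain an element of `𝒟`. -/
def residueCount (𝒟 : Finset ℕ) (p : ℕ) : ℕ :=
  (𝒟.image (fun d => d % p)).card

/-- The factor `(1 - 1/p)^(-k) * (1 - v_p(𝒟)/p)`, with `k = |𝒟|`, at the prime `p`. -/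
def singularFactor (𝒟 : Finset ℕ) (p : ℕ) : ℝ :=
  ((1 - 1 / (p : ℝ)) ^ 𝒟.card)⁻¹ * (1 - (residueCount 𝒟 p : ℝ) / (p : ℝ))

/-- The singular series `𝔖(𝒟; q)`, that is `(φ(q)/q)^(-k)` times the product over the primes
`p ∤ q` of `(1 - 1/p)^(-k) * (1 - v_p(𝒟)/p)`, where `k = |𝒟|`. The product converges absolutely. -/
def singularSeries (𝒟 : Finset ℕ) (q : ℕ) : ℝ :=
  (((Nat.totient q : ℝ) / (q : ℝ)) ^ 𝒟.card)⁻¹ *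
    ∏' p : Nat.Primes, if (p : ℕ) ∣ q then (1 : ℝ) else singularFactor 𝒟 p

/-- The integers `1 ≤ n ≤ N` with `(n, q) = 1`. -/
def coprimesUpTo (N q : ℕ) : Finset ℕ :=
  (Finset.Icc 1 N).filter (fun n => Nat.Coprime n q)

/-- The uniform variant of the Hardy–Littlewood prime `k`-tuple conjecture: with an absolute
`0 < δ < 1/2` and a constant that depends on `k` (and `δ`) only, uniformly in `q`, `N`, `D`
and in the set `𝒟 ⊆ [1, D]` of `k` distinct multiples of `q`. -/
def UniformPrimeTupleConjecture : Prop :=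
  ∃ δ : ℝ, 0 < δ ∧ δ < 1 / 2 ∧
    ∀ k : ℕ, 1 ≤ k → ∃ C : ℝ,
      ∀ q N D : ℕ, 1 ≤ q → 1 ≤ N → 1 ≤ D →
        ∀ 𝒟 : Finset ℕ, 𝒟 ⊆ Finset.Icc 1 D → 𝒟.card = k → (∀ d ∈ 𝒟, q ∣ d) →
          |(∑ n ∈ coprimesUpTo N q, ∏ d ∈ 𝒟, ArithmeticFunction.vonMangoldt (n + d))
              - singularSeries 𝒟 q * ((coprimesUpTo N q).card : ℝ)|
            ≤ C * ((N : ℝ) + (D : ℝ)) ^ (1 - δ)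

/-- `π(N; q, a)`, the number of primes `p ≤ N` with `p ≡ a (mod q)`. -/
def primeCountAP (N q a : ℕ) : ℕ :=
  ((Finset.Icc 1 N).filter (fun p => Nat.Prime p ∧ p ≡ a [MOD q])).card

/-- The number of reduced residue classes `a` modulo `q` with `π(N; q, a) = k`; every class is
represented once, by its least non-negative element. -/
def reducedResiduesWithCount (N q k : ℕ) : ℕ :=
  ((Finset.range q).filter (fun a => Nat.Coprime a q ∧ primeCountAP N q a = k)).card

end

/-! The proof is the method of moments in Gallagher's form. Put J = ⌊N/q⌋ and let Y(a) count the h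
in [1, J] with a + qh prime. The sum of C(Y(a), r) over reduced a counts pairs (a, H) with H ⊆ [1,
J], |H| = r and every a + qh prime. Weighting by Λ, the conjecture applied to 𝒟 = qH and to n ≤ q
evaluates the inner sum over a as (q/φ(q))^r φ(q) ∏_{p∤q}(...) up to O(N^(1-δ)). There are at most
J^r sets H, and J = O(log N) because φ(q) ≤ q, so the total error is negligible against φ(q), which
has order N/log N.

It remains to average the Euler product over H. Its mean value is 1, uniformly in q
(`exists_sum_singularProd_bounds`): the primes up to a small y are handled exactly by counting
residues modulo their product, and the larger primes contribute a factor 1 + o(1). The weighted r-th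
moment is therefore about φ(q) (qJ/φ(q))^r / r!, that is, φ(q) (λ log N)^r / r!. The weights are
removed using log φ(q) ~ log N and the scarcity of proper prime powers (`tendsto_moment`).

The limits λ^r/r! are the binomial moments of a Poisson variable, and the Bonferroni inequalities
turn them into point probabilities (`tendsto_poisson_of_factorial_moments`). Finally Y(a) is
replaced by π(N; q, a). They can differ only at h = 0 and at h = J, and both cases are rare.
Throughout, q = o(φ(q) log N) is needed; the elementary bound `le_sqrt_log_mul_totient` supplies it.
-/

/-! ### Averages of finite products of singular factors -/

theorem card_filter_range_mul_of_coprime {m n : ℕ} (hmn : Nat.Coprime m n) (hm : m ≠ 0)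
    (hn : n ≠ 0) (A B : ℕ → Prop) [DecidablePred A] [DecidablePred B]
    (hA : ∀ x, A (x % m) ↔ A x) (hB : ∀ x, B (x % n) ↔ B x) :
    ((Finset.range (m * n)).filter (fun x => A x ∧ B x)).card =
      ((Finset.range m).filter A).card * ((Finset.range n).filter B).card := by
  rw [← Finset.card_product]
  refine Finset.card_nbij (fun x => (x % m, x % n)) ?_ ?_ ?_
  · intro x hx
    simp only [Finset.coe_filter, Finset.mem_range, Set.mem_ofPred_eq, Finset.coe_product,
      Set.mem_prod] at hx ⊢
    exact ⟨⟨Nat.mod_lt _ (by omega), (hA x).2 hx.2.1⟩, ⟨Nat.mod_lt _ (by omega), (hB x).2 hx.2.2⟩⟩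
  · intro x hx y hy hxy
    simp only [Finset.coe_filter, Finset.mem_range, Set.mem_ofPred_eq] at hx hy
    simp only [Prod.mk.injEq] at hxy
    have : x ≡ y [MOD m * n] := (Nat.modEq_and_modEq_iff_modEq_mul hmn).1 ⟨hxy.1, hxy.2⟩
    exact Nat.ModEq.eq_of_lt_of_lt this hx.1 hy.1
  · rintro ⟨a, b⟩ hab
    simp only [Finset.coe_filter, Finset.mem_range, Set.mem_ofPred_eq, Finset.coe_product,
      Set.mem_prod] at hab
    obtain ⟨⟨ha, hA'⟩, ⟨hb, hB'⟩⟩ := hab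
    have h1 := (Nat.chineseRemainder hmn a b).2
    have h2 := Nat.chineseRemainder_lt_mul hmn a b hm hn
    set z := (Nat.chineseRemainder hmn a b : ℕ) with hz
    have e1 : z % m = a := by rw [h1.1, Nat.mod_eq_of_lt ha]
    have e2 : z % n = b := by rw [h1.2, Nat.mod_eq_of_lt hb]
    refine ⟨z, ?_, by simp [e1, e2]⟩
    simp only [Finset.coe_filter, Finset.mem_range, Set.mem_ofPred_eq]
    exact ⟨h2, (hA z).1 (e1 ▸ hA'), (hB z).1 (e2 ▸ hB')⟩

theorem residueCount_le_card (H : Finset ℕ) (p : ℕ) : residueCount H p ≤ H.card :=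
  Finset.card_image_le

theorem residueCount_le {H : Finset ℕ} {p : ℕ} (hp : 0 < p) : residueCount H p ≤ p := by
  have : H.image (fun d => d % p) ⊆ Finset.range p := by
    intro x hx
    obtain ⟨d, -, rfl⟩ := Finset.mem_image.1 hx
    exact Finset.mem_range.2 (Nat.mod_lt _ hp)
  simpa [residueCount] using Finset.card_le_card this

theorem card_filter_range_prime {p : ℕ} (hp : p.Prime) (H : Finset ℕ) :
    ((Finset.range p).filter (fun n => ∀ h ∈ H, Nat.Coprime (n + h) p)).card =
      p - residueCount H p := by
  have hcompl : ((Finset.range p).filter (fun n => ¬ ∀ h ∈ H, Nat.Coprime (n + h) p)).card =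
      residueCount H p := by
    unfold residueCount
    symm
    have hp0 := hp.pos
    -- The bad n are the negatives modulo p of the residues occupied by H.
    refine Finset.card_nbij (fun r => (p - r) % p) ?_ ?_ ?_
    · intro r hr
      simp only [Finset.coe_image, Set.mem_image, Finset.mem_coe] at hr
      obtain ⟨h, hh, rfl⟩ := hr
      simp only [Finset.coe_filter, Finset.mem_range, Set.mem_ofPred_eq]
      refine ⟨Nat.mod_lt _ hp0, ?_⟩
      push Not
      refine ⟨h, hh, ?_⟩
      change ¬ Nat.Coprime _ _
      rw [Nat.coprime_comm, hp.coprime_iff_not_dvd, not_not, Nat.dvd_iff_mod_eq_zero,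
        Nat.mod_add_mod]
      have := Nat.mod_lt h hp0
      rw [← Nat.add_mod_mod, Nat.sub_add_cancel this.le, Nat.mod_self]
    · intro r hr s hs hrs
      simp only [Finset.coe_image, Set.mem_image, Finset.mem_coe] at hr hs
      obtain ⟨h, hh, rfl⟩ := hr
      obtain ⟨h', hh', rfl⟩ := hs
      have h1 := Nat.mod_lt h hp0
      have h2 := Nat.mod_lt h' hp0
      simp only at hrs
      generalize h % p = r at *
      generalize h' % p = s at *
      rcases Nat.eq_zero_or_pos r with rfl | hr <;> rcases Nat.eq_zero_or_pos s with rfl | hs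
      · rfl
      · rw [Nat.sub_zero, Nat.mod_self, Nat.mod_eq_of_lt (by omega)] at hrs; omega
      · rw [Nat.sub_zero, Nat.mod_self, Nat.mod_eq_of_lt (by omega)] at hrs; omega
      · rw [Nat.mod_eq_of_lt (by omega), Nat.mod_eq_of_lt (by omega)] at hrs; omega
    · intro n hn
      simp only [Finset.coe_filter, Finset.mem_range, Set.mem_ofPred_eq] at hn
      obtain ⟨hn, hn'⟩ := hn
      push Not at hn'
      obtain ⟨h, hh, hnh⟩ := hn'
      change ¬ Nat.Coprime _ _ at hnh
      rw [Nat.coprime_comm, hp.coprime_iff_not_dvd, not_not] at hnh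
      refine ⟨h % p, by simpa using ⟨h, hh, rfl⟩, ?_⟩
      have h1 := Nat.mod_lt h hp0
      have h3 : (n + h % p) % p = 0 := by
        rw [Nat.add_mod_mod]; exact Nat.mod_eq_zero_of_dvd hnh
      simp only
      generalize h % p = r at *
      obtain ⟨c, hc⟩ := Nat.dvd_of_mod_eq_zero h3
      have : c < 2 := by
        by_contra hcc
        have : p * 2 ≤ p * c := Nat.mul_le_mul_left _ (by omega)
        omega
      interval_cases c
      · have : n = 0 := by omega
        have : r = 0 := by omega
        subst_vars; simp
      · rw [show p - r = n by omega, Nat.mod_eq_of_lt hn]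
  have := Finset.card_filter_add_card_filter_not (s := Finset.range p)
    (fun n => ∀ h ∈ H, Nat.Coprime (n + h) p)
  rw [hcompl, Finset.card_range] at this
  omega

theorem card_filter_range_prod (S : Finset ℕ) (hS : ∀ p ∈ S, p.Prime) (H : Finset ℕ) :
    ((Finset.range (∏ p ∈ S, p)).filter (fun n => ∀ h ∈ H, Nat.Coprime (n + h) (∏ p ∈ S, p))).card
      = ∏ p ∈ S, (p - residueCount H p) := by
  induction S using Finset.induction_on with
  | empty => simp
  | insert p S hpS ih =>
    have hp := hS p (Finset.mem_insert_self _ _)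
    have hS' : ∀ p ∈ S, p.Prime := fun r hr => hS r (Finset.mem_insert_of_mem hr)
    rw [Finset.prod_insert hpS, Finset.prod_insert hpS, ← ih hS', ← card_filter_range_prime hp]
    have hco : Nat.Coprime p (∏ r ∈ S, r) := Nat.Coprime.prod_right fun r hr =>
      (Nat.coprime_primes hp (hS' r hr)).2 (fun h => hpS (h ▸ hr))
    rw [← card_filter_range_mul_of_coprime hco hp.ne_zero
      (Finset.prod_ne_zero_iff.2 fun r hr => (hS' r hr).ne_zero)]
    · congr 1
      ext n
      simp only [Finset.mem_filter, Finset.mem_range, Nat.coprime_mul_iff_right]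
      grind
    · intro x
      refine forall₂_congr fun h _ => ?_
      simp [Nat.Coprime, Nat.gcd_comm _ p, Nat.gcd_rec p (_ + _)]
    · intro x
      refine forall₂_congr fun h _ => ?_
      simp [Nat.Coprime, Nat.gcd_comm _ (∏ r ∈ S, r), Nat.gcd_rec (∏ r ∈ S, r) (_ + _)]

theorem card_filter_coprime_Ico_mul (P m a : ℕ) :
    ((Finset.Ico a (a + P * m)).filter (Nat.Coprime P)).card = P.totient * m := by
  induction m with
  | zero => simp
  | succ m ih =>
    rw [← Finset.Ico_union_Ico_eq_Ico (b := a + P * m) (by omega) (by grind),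
      Finset.filter_union, Finset.card_union_of_disjoint, ih,
      show a + P * (m + 1) = (a + P * m) + P by ring, Nat.filter_coprime_Ico_eq_totient]
    · ring
    · exact Finset.disjoint_filter_filter (Finset.Ico_disjoint_Ico_consecutive _ _ _)

/-- Each complete period of length P contains exactly φ(P) integers coprime to P, and J consecutive
integers contain ⌊J/P⌋ periods and lie in ⌊J/P⌋ + 1 of them. -/
theorem abs_card_filter_coprime_sub_le {P : ℕ} (hP : 0 < P) (J n : ℕ) :
    |(((Finset.Icc 1 J).filter (fun h => Nat.Coprime (n + h) P)).card : ℝ)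
      - J * (P.totient / P)| ≤ P.totient := by
  have key : ((Finset.Icc 1 J).filter (fun h => Nat.Coprime (n + h) P)).card =
      ((Finset.Ico (n + 1) (n + 1 + J)).filter (Nat.Coprime P)).card := by
    refine Finset.card_nbij (fun h => n + h) ?_ ?_ ?_
    · intro h hh
      simp only [Finset.coe_filter, Finset.mem_Icc, Set.mem_ofPred_eq, Finset.mem_Ico] at hh ⊢
      exact ⟨by omega, hh.2.symm⟩
    · intro x _ y _ hxy
      simpa using hxy
    · intro x hx
      simp only [Finset.coe_filter, Set.mem_ofPred_eq, Finset.mem_Ico] at hx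
      refine ⟨x - n, ?_, by simp; omega⟩
      simp only [Finset.coe_filter, Finset.mem_Icc, Set.mem_ofPred_eq]
      rw [show n + (x - n) = x by omega]
      exact ⟨by omega, hx.2.symm⟩
  have hub := Nat.Ico_filter_coprime_le (n + 1) J hP.ne'
  have hlb : P.totient * (J / P) ≤
      ((Finset.Ico (n + 1) (n + 1 + J)).filter (Nat.Coprime P)).card := by
    rw [← card_filter_coprime_Ico_mul P (J / P) (n + 1)]
    apply Finset.card_le_card
    apply Finset.filter_subset_filter
    apply Finset.Ico_subset_Ico_right
    have := Nat.mul_div_le J P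
    omega
  rw [key]
  set c := ((Finset.Ico (n + 1) (n + 1 + J)).filter (Nat.Coprime P)).card
  have hP' : (0 : ℝ) < P := by exact_mod_cast hP
  have e1 : ((J / P : ℕ) : ℝ) ≤ J / P := Nat.cast_div_le
  have e2 : (J : ℝ) / P ≤ (J / P : ℕ) + 1 := by
    rw [div_le_iff₀ hP']
    exact_mod_cast (Nat.lt_mul_of_div_lt (Nat.lt_succ_self _) hP).le.trans (by rw [Nat.succ_eq_add_one])
  have hub' : (c : ℝ) ≤ P.totient * ((J / P : ℕ) + 1) := by exact_mod_cast hub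
  have hlb' : (P.totient : ℝ) * (J / P : ℕ) ≤ c := by exact_mod_cast hlb
  have ht : (0 : ℝ) ≤ P.totient := Nat.cast_nonneg _
  have e3 : (J : ℝ) * (P.totient / P) = P.totient * (J / P) := by ring
  rw [e3, abs_le]
  constructor <;> nlinarith

/-- Double counting of pairs (H, n). It serves twice: for residues n modulo P with n + h coprime to
P, and for the factorial moments of the prime counts. -/
theorem sum_powersetCard_card_filter {α β : Type*} [DecidableEq α] (k : ℕ) (s : Finset α)
    (T : Finset β) (R : β → α → Prop) [∀ b, DecidablePred (R b)] :
    ∑ H ∈ s.powersetCard k, (T.filter (fun n => ∀ h ∈ H, R n h)).card =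
      ∑ n ∈ T, ((s.filter (R n)).card).choose k := by
  simp_rw [Finset.card_filter, ← Finset.card_filter, ← Finset.card_powersetCard]
  rw [Finset.sum_congr rfl fun H _ => Finset.card_filter _ _, Finset.sum_comm]
  refine Finset.sum_congr rfl fun n _ => ?_
  rw [← Finset.card_filter]
  congr 1
  ext H
  simp only [Finset.mem_filter, Finset.mem_powersetCard, Finset.subset_iff]
  grind

theorem residueCount_singleton_zero (p : ℕ) : residueCount {0} p = 1 := by
  simp [residueCount]

theorem totient_prod_primes (S : Finset ℕ) (hS : ∀ p ∈ S, p.Prime) :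
    (∏ p ∈ S, p).totient = ∏ p ∈ S, (p - 1) := by
  have := card_filter_range_prod S hS {0}
  simp only [residueCount_singleton_zero, Finset.mem_singleton, forall_eq, add_zero] at this
  rw [← this, Nat.totient]
  congr 1
  ext n
  simp [Nat.coprime_comm]

theorem one_sub_inv_pos_of_prime {p : ℕ} (hp : p.Prime) : (0 : ℝ) < 1 - 1 / p := by
  have : (1 : ℝ) < p := by exact_mod_cast hp.one_lt
  rw [sub_pos, div_lt_one (by linarith)]
  exact this

theorem singularFactor_nonneg {p : ℕ} (hp : p.Prime) (H : Finset ℕ) : 0 ≤ singularFactor H p := by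
  have h0 : (0 : ℝ) < p := by exact_mod_cast hp.pos
  unfold singularFactor
  have h1 := one_sub_inv_pos_of_prime hp
  have h2 : (residueCount H p : ℝ) / p ≤ 1 := by
    rw [div_le_one h0]
    exact_mod_cast residueCount_le hp.pos
  have : 0 ≤ 1 - (residueCount H p : ℝ) / p := by linarith
  positivity

/-- By the Chinese remainder theorem, ∏(1 - v_p/p) is the density of the n for which all n + h are
coprime to P = ∏ p. The product compares this density with the value (φ(P)/P)^k expected under
independence. -/
theorem prod_singularFactor_eq (S : Finset ℕ) (hS : ∀ p ∈ S, p.Prime) (H : Finset ℕ) :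
    ∏ p ∈ S, singularFactor H p =
      ((((∏ p ∈ S, p).totient / (∏ p ∈ S, p : ℕ) : ℝ)) ^ H.card)⁻¹ *
        (((Finset.range (∏ p ∈ S, p)).filter
          (fun n => ∀ h ∈ H, Nat.Coprime (n + h) (∏ p ∈ S, p))).card / (∏ p ∈ S, p : ℕ)) := by
  rw [card_filter_range_prod S hS, totient_prod_primes S hS]
  push_cast
  rw [← Finset.prod_div_distrib, ← Finset.prod_div_distrib, ← Finset.prod_pow,
    ← Finset.prod_inv_distrib, ← Finset.prod_mul_distrib]
  refine Finset.prod_congr rfl fun p hp => ?_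
  have h0 : (p : ℝ) ≠ 0 := by exact_mod_cast (hS p hp).ne_zero
  rw [Nat.cast_sub (residueCount_le (hS p hp).pos), Nat.cast_sub (hS p hp).one_le, sub_div,
    sub_div, div_self h0, Nat.cast_one, singularFactor]

theorem sum_prod_singularFactor_eq (k J : ℕ) (S : Finset ℕ) (hS : ∀ p ∈ S, p.Prime) :
    ∑ H ∈ (Finset.Icc 1 J).powersetCard k, ∏ p ∈ S, singularFactor H p =
      ((((∏ p ∈ S, p).totient / (∏ p ∈ S, p : ℕ) : ℝ)) ^ k)⁻¹ *
        ((∑ n ∈ Finset.range (∏ p ∈ S, p), ((((Finset.Icc 1 J).filter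
          (fun h => Nat.Coprime (n + h) (∏ p ∈ S, p))).card).choose k : ℝ)) / (∏ p ∈ S, p : ℕ)) := by
  have := sum_powersetCard_card_filter k (Finset.Icc 1 J) (Finset.range (∏ p ∈ S, p))
    (fun n h => Nat.Coprime (n + h) (∏ p ∈ S, p))
  rw [← Nat.cast_sum, ← this, Nat.cast_sum, Finset.sum_div, Finset.mul_sum]
  refine Finset.sum_congr rfl fun H hH => ?_
  rw [prod_singularFactor_eq S hS, (Finset.mem_powersetCard.1 hH).2]

theorem choose_bounds_of_abs_sub_le {c k : ℕ} {x u t : ℝ} (hx : 0 < x) (hc : |(c : ℝ) - x| ≤ u)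
    (htx : u + k ≤ t * x) (ht1 : t ≤ 1) :
    (1 - t) ^ k * x ^ k / k.factorial ≤ c.choose k ∧
      (c.choose k : ℝ) ≤ (1 + t) ^ k * x ^ k / k.factorial := by
  rw [abs_le] at hc
  have hk0 : (0 : ℝ) ≤ k := Nat.cast_nonneg k
  have hf : (0 : ℝ) < k.factorial := by exact_mod_cast k.factorial_pos
  constructor
  · rw [div_le_iff₀ hf, ← mul_pow]
    have h1 : ((c + 1 - k : ℕ) : ℝ) ^ k ≤ c.choose k * k.factorial := by
      have := Nat.pow_sub_le_descFactorial c k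
      rw [Nat.descFactorial_eq_factorial_mul_choose, mul_comm] at this
      exact_mod_cast this
    refine le_trans (pow_le_pow_left₀ (mul_nonneg (by linarith) hx.le) ?_ k) h1
    have h2 : (c : ℝ) + 1 ≤ ((c + 1 - k : ℕ) : ℝ) + k := by
      have : c + 1 ≤ (c + 1 - k) + k := by omega
      exact_mod_cast this
    nlinarith
  · refine (Nat.choose_le_pow_div k c).trans ?_
    rw [← mul_pow]
    gcongr
    nlinarith

/-- After exchanging sums, each residue n contributes C(c, k), where c = Jφ(P)/P + O(φ(P)). Since P
≤ √J, the relative error in c is O(1/√J), whatever the set S. -/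
theorem sum_prod_singularFactor_bounds {k J : ℕ} (S : Finset ℕ) (hS : ∀ p ∈ S, p.Prime)
    (hJ : 0 < J) (hPJ : (∏ p ∈ S, p) ^ 2 ≤ J) (ht : (k + 1) / √(J : ℝ) ≤ 1) :
    (1 - (k + 1) / √(J : ℝ)) ^ k / k.factorial * J ^ k ≤
        ∑ H ∈ (Finset.Icc 1 J).powersetCard k, ∏ p ∈ S, singularFactor H p ∧
      ∑ H ∈ (Finset.Icc 1 J).powersetCard k, ∏ p ∈ S, singularFactor H p ≤
        (1 + (k + 1) / √(J : ℝ)) ^ k / k.factorial * J ^ k := by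
  rw [sum_prod_singularFactor_eq k J S hS]
  have hP0 : 0 < ∏ p ∈ S, p := Finset.prod_pos fun p hp => (hS p hp).pos
  generalize ∏ p ∈ S, p = P at *
  have hJ' : (0 : ℝ) < J := by exact_mod_cast hJ
  have hP' : (0 : ℝ) < P := by exact_mod_cast hP0
  have hs : 0 < √(J : ℝ) := Real.sqrt_pos.2 hJ'
  have hss : √(J : ℝ) * √(J : ℝ) = J := Real.mul_self_sqrt hJ'.le
  have hφ : (1 : ℝ) ≤ P.totient := by exact_mod_cast Nat.totient_pos.2 hP0
  have hPs : (P : ℝ) ≤ √(J : ℝ) := Real.le_sqrt_of_sq_le (by exact_mod_cast hPJ)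
  set x : ℝ := J * (P.totient / P) with hx
  have hx0 : 0 < x := by positivity
  set t : ℝ := (k + 1) / √(J : ℝ) with htdef
  have hk0 : (0 : ℝ) ≤ k := Nat.cast_nonneg k
  -- As φ(P) ≥ 1, the left side is at most (k + 1)φ(P), while t x = (k + 1)φ(P)·√J/P with √J/P ≥ 1.
  have htx : (P.totient : ℝ) + k ≤ t * x := by
    have h1 : t * x = (k + 1) * P.totient * (√(J : ℝ) / P) := by
      calc t * x = (k + 1) / √(J : ℝ) * (√(J : ℝ) * √(J : ℝ) * (P.totient / P)) := by
            rw [htdef, hx, hss]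
        _ = _ := by field_simp
    have h2 : 1 ≤ √(J : ℝ) / P := by rwa [le_div_iff₀ hP', one_mul]
    have h3 : (k + 1) * (P.totient : ℝ) * 1 ≤ (k + 1) * P.totient * (√(J : ℝ) / P) := by gcongr
    rw [h1]; nlinarith
  have hb := fun n : ℕ => choose_bounds_of_abs_sub_le hx0
    (abs_card_filter_coprime_sub_le hP0 J n) htx ht
  have hA : ∀ A : ℝ, ((P.totient / P : ℝ) ^ k)⁻¹ * ((∑ n ∈ Finset.range P, A * x ^ k / k.factorial) / P)
      = A / k.factorial * J ^ k := by
    intro A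
    rw [Finset.sum_const, Finset.card_range, nsmul_eq_mul, hx, mul_pow]
    have : (P.totient / P : ℝ) ^ k ≠ 0 := by positivity
    field_simp
  rw [← hA, ← hA]
  constructor
  · gcongr with n hn
    exact (hb n).1
  · gcongr with n hn
    exact (hb n).2

/-! ### The tail of the singular product -/

theorem one_sub_pow_le {u : ℝ} (hu0 : 0 ≤ u) (hu1 : u ≤ 1) (k : ℕ) :
    (1 - u) ^ k ≤ 1 - k * u + k ^ 2 * u ^ 2 := by
  induction k with
  | zero => simp
  | succ k ih =>
    rw [pow_succ]
    have hk : (0 : ℝ) ≤ k := Nat.cast_nonneg k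
    refine (mul_le_mul_of_nonneg_right ih (by linarith)).trans ?_
    push_cast
    have : 0 ≤ (k : ℝ) ^ 2 * u ^ 3 := by positivity
    have : 0 ≤ (k : ℝ) * u ^ 2 := by positivity
    have : 0 ≤ u ^ 2 := by positivity
    nlinarith

/-- If H occupies k distinct residues, the terms of order 1/p in (1 - k/p) and (1 - 1/p)^k cancel.
Only for the exceptional primes, where two elements of H collide, does an error of order 1/p
survive. -/
theorem abs_singularFactor_sub_one_le {p k : ℕ} (hp : p.Prime) {H : Finset ℕ} (hk : H.card = k)
    (hkp : 2 * k ≤ p) :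
    |singularFactor H p - 1| ≤ 2 * k ^ 2 * (1 / (p : ℝ) ^ 2) +
      if residueCount H p < k then 2 * k * (1 / (p : ℝ)) else 0 := by
  have hp0 : (0 : ℝ) < p := by exact_mod_cast hp.pos
  have hkp' : (2 : ℝ) * k ≤ p := by exact_mod_cast hkp
  set u : ℝ := 1 / p with hu
  have hu0 : 0 < u := by positivity
  have hu1 : u ≤ 1 := by
    rw [hu, div_le_one hp0]; exact_mod_cast hp.one_le
  have hku : k * u ≤ 1 / 2 := by
    rw [hu, mul_one_div, div_le_iff₀ hp0]; linarith
  have hlow : 1 - k * u ≤ (1 - u) ^ k := by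
    have := one_add_mul_le_pow (a := -u) (by linarith) k
    rw [← sub_eq_add_neg] at this
    linarith
  have hup := one_sub_pow_le hu0.le hu1 k
  have hup1 : (1 - u) ^ k ≤ 1 := pow_le_one₀ (by linarith) (by linarith)
  -- Dividing by (1 - u)^k therefore costs at most the factor 2 in the final bound.
  have hhalf : 1 / 2 ≤ (1 - u) ^ k := by linarith
  have hpos : 0 < (1 - u) ^ k := by linarith
  have hv := residueCount_le_card H p
  rw [hk] at hv
  have heq : singularFactor H p - 1 = (1 - residueCount H p * u - (1 - u) ^ k) / (1 - u) ^ k := by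
    rw [singularFactor, hk, ← hu, sub_div _ _ ((1 - u) ^ k), div_self hpos.ne', hu]
    field_simp
  have hle : |singularFactor H p - 1| ≤ 2 * |1 - residueCount H p * u - (1 - u) ^ k| := by
    rw [heq, abs_div, abs_of_pos hpos, div_le_iff₀ hpos]
    nlinarith [abs_nonneg (1 - residueCount H p * u - (1 - u) ^ k)]
  have hu2 : 1 / (p : ℝ) ^ 2 = u ^ 2 := by rw [hu, one_div_pow]
  rw [hu2]
  have hv' : (residueCount H p : ℝ) ≤ k := by exact_mod_cast hv
  have hvu : residueCount H p * u ≤ k * u := by gcongr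
  have hvu0 : 0 ≤ residueCount H p * u := by positivity
  have hkk : 0 ≤ (k : ℝ) ^ 2 * u ^ 2 := by positivity
  refine hle.trans ?_
  split_ifs with h
  · have : |1 - residueCount H p * u - (1 - u) ^ k| ≤ k ^ 2 * u ^ 2 + k * u := by
      rw [abs_le]; constructor <;> linarith
    linarith
  · have hvk : residueCount H p = k := by omega
    rw [hvk]
    have : |1 - k * u - (1 - u) ^ k| ≤ k ^ 2 * u ^ 2 := by
      rw [abs_le]; constructor <;> linarith
    linarith

/-- The product of the distances between the distinct elements of `H`. -/
def distProd (H : Finset ℕ) : ℕ := ∏ x ∈ H.offDiag, Nat.dist x.1 x.2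

theorem distProd_ne_zero (H : Finset ℕ) : distProd H ≠ 0 := by
  refine Finset.prod_ne_zero_iff.2 fun x hx h => ?_
  exact (Finset.mem_offDiag.1 hx).2.2 (Nat.eq_of_dist_eq_zero h)

theorem distProd_le {H : Finset ℕ} {J : ℕ} (hJ : 0 < J) (hH : H ⊆ Finset.Icc 1 J) :
    distProd H ≤ J ^ (H.card ^ 2) := by
  calc distProd H ≤ J ^ H.offDiag.card := by
        refine Finset.prod_le_pow_card _ _ _ fun x hx => ?_
        obtain ⟨h1, h2, -⟩ := Finset.mem_offDiag.1 hx
        have h1 := Finset.mem_Icc.1 (hH h1)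
        have h2 := Finset.mem_Icc.1 (hH h2)
        unfold Nat.dist
        omega
    _ ≤ J ^ (H.card ^ 2) := by
        refine Nat.pow_le_pow_right hJ ?_
        rw [Finset.offDiag_card, sq]
        exact Nat.sub_le _ _

theorem dvd_distProd_of_residueCount_lt {H : Finset ℕ} {p : ℕ} (h : residueCount H p < H.card) :
    p ∣ distProd H := by
  obtain ⟨x, hx, y, hy, hxy, hmod⟩ := Finset.exists_ne_map_eq_of_card_lt_of_maps_to
    (f := fun d => d % p) h (fun d hd => Finset.mem_coe.2 (Finset.mem_image_of_mem _ hd))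
  have : p ∣ Nat.dist x y := by
    unfold Nat.dist
    rcases le_total x y with hle | hle
    · rw [Nat.sub_eq_zero_of_le hle, zero_add]
      exact (Nat.modEq_iff_dvd' hle).1 hmod
    · rw [Nat.sub_eq_zero_of_le hle, add_zero]
      exact (Nat.modEq_iff_dvd' hle).1 hmod.symm
  have hmem : (x, y) ∈ H.offDiag := Finset.mem_offDiag.2 ⟨hx, hy, hxy⟩
  exact this.trans (Finset.dvd_prod_of_mem (fun x : ℕ × ℕ => Nat.dist x.1 x.2) hmem)

theorem card_filter_primeFactors_mul_log_le {Q y : ℕ} (hQ : Q ≠ 0) :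
    ((Q.primeFactors.filter (fun p => y < p)).card : ℝ) * Real.log y ≤ Real.log Q := by
  rcases Nat.eq_zero_or_pos y with rfl | hy
  · simp [Real.log_natCast_nonneg]
  have h1 : y ^ (Q.primeFactors.filter (fun p => y < p)).card ≤ Q := by
    calc _ ≤ ∏ p ∈ Q.primeFactors.filter (fun p => y < p), p :=
          Finset.pow_card_le_prod _ _ _ fun p hp => (Finset.mem_filter.1 hp).2.le
      _ ≤ Q := Nat.le_of_dvd (Nat.pos_of_ne_zero hQ)
          ((Finset.prod_dvd_prod_of_subset _ _ _ (Finset.filter_subset _ _)).trans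
            (Nat.prod_primeFactors_dvd Q))
  rw [← Real.log_pow]
  exact Real.log_le_log (by positivity) (by exact_mod_cast h1)

/-- The primes in a finite set of natural numbers. -/
def primesIn (S : Finset ℕ) : Finset Nat.Primes :=
  (S.subtype Nat.Prime : Finset {p : ℕ // p.Prime})

theorem mem_primesIn {S : Finset ℕ} {p : Nat.Primes} : p ∈ primesIn S ↔ (p : ℕ) ∈ S :=
  Finset.mem_subtype (p := Nat.Prime) (a := p)

theorem card_primesIn_le (S : Finset ℕ) : (primesIn S).card ≤ S.card :=
  (Finset.card_subtype Nat.Prime S).trans_le (Finset.card_filter_le _ _)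

theorem prod_primesIn {S : Finset ℕ} (hS : ∀ p ∈ S, p.Prime) (f : ℕ → ℝ) :
    ∏ p ∈ primesIn S, f p = ∏ p ∈ S, f p :=
  Finset.prod_subtype_of_mem f hS

/-- The constant `∑ p, p ^ (-3/2)`. -/
noncomputable def primeZeta : ℝ := ∑' p : Nat.Primes, (p : ℝ) ^ (-(3 / 2) : ℝ)

/-- Bound for the total deviation from `1` of the singular factors at the primes above `y`. -/
noncomputable def tailBound (k y J : ℕ) : ℝ :=
  2 * k ^ 2 * ((y : ℝ) ^ (-(1 / 2) : ℝ) * primeZeta) +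
    2 * k * (k ^ 2 * Real.log J / (y * Real.log y))

/-- The singular factor at `p` if `p > y` and `p ∤ q`, and `1` otherwise. -/
noncomputable def tailFactor (H : Finset ℕ) (q y p : ℕ) : ℝ :=
  if p ∣ q ∨ p ≤ y then 1 else singularFactor H p

/-- Exceptional primes divide the product of the differences of H, which is at most J^(k²). So at
most k² log J / log y of them exceed y, and each costs at most 2k/y. The remaining deviations are
O(1/p²). -/
theorem summable_and_tsum_tailFactor_le {H : Finset ℕ} {J k y : ℕ} (q : ℕ) (hJ : 0 < J)
    (hH : H ⊆ Finset.Icc 1 J) (hk : H.card = k) (hy : 2 ≤ y) (hky : 2 * k ≤ y) :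
    Summable (fun p : Nat.Primes => |tailFactor H q y p - 1|) ∧
      ∑' p : Nat.Primes, |tailFactor H q y p - 1| ≤ tailBound k y J := by
  have hy0 : (0 : ℝ) < y := by positivity
  have hlogy : 0 < Real.log y := Real.log_pos (by exact_mod_cast hy)
  set b : Nat.Primes → ℝ := fun p =>
    2 * k ^ 2 * ((y : ℝ) ^ (-(1 / 2) : ℝ) * (p : ℝ) ^ (-(3 / 2) : ℝ)) with hb
  set B : Finset ℕ := (distProd H).primeFactors.filter (fun p => y < p) with hB
  set B' : Finset Nat.Primes := primesIn B with hB'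
  set i : Nat.Primes → ℝ := fun p => if p ∈ B' then 2 * k * (1 / (y : ℝ)) else 0 with hi
  have hsb0 : Summable (fun p : Nat.Primes => (p : ℝ) ^ (-(3 / 2) : ℝ)) :=
    Nat.Primes.summable_rpow.2 (by norm_num)
  have hsb : Summable b := (hsb0.mul_left _).mul_left _
  have hsi : Summable i := summable_of_ne_finset_zero (s := B') (by intro p hp; simp [hi, hp])
  have hle : ∀ p : Nat.Primes, |tailFactor H q y p - 1| ≤ b p + i p := by
    intro p
    have hp0 : (0 : ℝ) < p := by exact_mod_cast p.2.pos
    have hb0 : 0 ≤ b p := by positivity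
    have hi0 : 0 ≤ i p := by
      simp only [hi]; split_ifs <;> positivity
    unfold tailFactor
    split_ifs with h
    · simp only [sub_self, abs_zero]; positivity
    · push Not at h
      have hyp : (y : ℝ) ≤ p := by exact_mod_cast h.2.le
      refine (abs_singularFactor_sub_one_le p.2 hk (by omega)).trans (add_le_add ?_ ?_)
      · simp only [hb]
        -- Splitting the exponent gives decay in y from the first factor and keeps a convergent
        -- series in the second.
        have : 1 / (p : ℝ) ^ 2 = (p : ℝ) ^ (-(1 / 2) : ℝ) * (p : ℝ) ^ (-(3 / 2) : ℝ) := by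
          rw [← Real.rpow_add hp0, show (-(1 / 2) + -(3 / 2) : ℝ) = -(2 : ℕ) by norm_num,
            Real.rpow_neg hp0.le, Real.rpow_natCast, one_div]
        rw [this]
        gcongr 2 * k ^ 2 * (?_ * _)
        exact Real.rpow_le_rpow_of_nonpos hy0 hyp (by norm_num)
      · split_ifs with hc
        · have : p ∈ B' := by
            simp only [hB', hB, mem_primesIn, Finset.mem_filter, Nat.mem_primeFactors]
            exact ⟨⟨p.2, dvd_distProd_of_residueCount_lt (hk ▸ hc), distProd_ne_zero H⟩, h.2⟩
          simp only [hi, this, if_true]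
          gcongr
        · exact hi0
  have hs : Summable (fun p : Nat.Primes => |tailFactor H q y p - 1|) :=
    (hsb.add hsi).of_nonneg_of_le (fun p => abs_nonneg _) hle
  refine ⟨hs, (hs.tsum_le_tsum hle (hsb.add hsi)).trans ?_⟩
  rw [hsb.tsum_add hsi, tailBound]
  refine add_le_add (le_of_eq ?_) ?_
  · rw [tsum_mul_left, tsum_mul_left, primeZeta]
  · rw [tsum_eq_sum (s := B') (by intro p hp; simp [hi, hp])]
    rw [Finset.sum_congr rfl (g := fun _ => 2 * k * (1 / (y : ℝ)))
      (by intro p hp; simp [hi, hp]), Finset.sum_const, nsmul_eq_mul]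
    have hcard : B'.card ≤ B.card := card_primesIn_le B
    have h1 : (B.card : ℝ) * Real.log y ≤ k ^ 2 * Real.log J := by
      refine (card_filter_primeFactors_mul_log_le (distProd_ne_zero H)).trans ?_
      have := distProd_le hJ hH
      rw [hk] at this
      have h2 : Real.log (distProd H) ≤ Real.log ((J : ℝ) ^ (k ^ 2)) :=
        Real.log_le_log (by exact_mod_cast Nat.pos_of_ne_zero (distProd_ne_zero H))
          (by exact_mod_cast this)
      rw [Real.log_pow] at h2
      exact_mod_cast h2
    have h3 : (B'.card : ℝ) ≤ k ^ 2 * Real.log J / Real.log y := by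
      rw [le_div_iff₀ hlogy]
      refine le_trans ?_ h1
      gcongr
    calc (B'.card : ℝ) * (2 * k * (1 / (y : ℝ)))
        ≤ (k ^ 2 * Real.log J / Real.log y) * (2 * k * (1 / (y : ℝ))) := by gcongr
      _ = _ := by field_simp

/-- The Euler product of the singular series over the primes not dividing `q`. -/
noncomputable def singularProd (H : Finset ℕ) (q : ℕ) : ℝ :=
  ∏' p : Nat.Primes, if (p : ℕ) ∣ q then (1 : ℝ) else singularFactor H p

/-- The product splits at y, and the tail ∏(1 + f) satisfies |∏(1 + f) - 1| ≤ exp(∑|f|) - 1. The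
error is relative to the nonnegative finite product, so it can be summed over H. -/
theorem abs_singularProd_sub_le {H : Finset ℕ} {J k y : ℕ} (q : ℕ) (hJ : 0 < J)
    (hH : H ⊆ Finset.Icc 1 J) (hk : H.card = k) (hy : 2 ≤ y) (hky : 2 * k ≤ y) :
    |singularProd H q -
        ∏ p ∈ (Finset.Icc 1 y).filter (fun p => p.Prime ∧ ¬ p ∣ q), singularFactor H p| ≤
      (∏ p ∈ (Finset.Icc 1 y).filter (fun p => p.Prime ∧ ¬ p ∣ q), singularFactor H p) *
        (Real.exp (tailBound k y J) - 1) := by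
  obtain ⟨hs, hle⟩ := summable_and_tsum_tailFactor_le q hJ hH hk hy hky
  set S := (Finset.Icc 1 y).filter (fun p => p.Prime ∧ ¬ p ∣ q) with hS
  set S' : Finset Nat.Primes := primesIn S with hS'
  set u : Nat.Primes → ℝ := fun p => if p ∈ S' then singularFactor H p else 1 with hu
  have hmemS : ∀ p : Nat.Primes, p ∈ S' ↔ (p : ℕ) ≤ y ∧ ¬ (p : ℕ) ∣ q := by
    intro p
    simp only [hS', hS, mem_primesIn, Finset.mem_filter, Finset.mem_Icc]
    have := p.2
    have := p.2.one_le
    tauto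
  have hu1 : ∀ p ∉ S', u p = 1 := by intro p hp; simp [hu, hp]
  have hmu : Multipliable u := multipliable_of_ne_finset_one hu1
  have hprodu : ∏' p, u p = ∏ p ∈ S, singularFactor H p := by
    rw [tprod_eq_prod hu1, Finset.prod_congr rfl (g := fun p : Nat.Primes => singularFactor H p)
      (by intro p hp; simp [hu, hp])]
    exact prod_primesIn (fun p hp => (Finset.mem_filter.1 hp).2.1) (singularFactor H)
  set f : Nat.Primes → ℝ := fun p => tailFactor H q y p - 1 with hf
  have hmf : Multipliable (fun p => 1 + f p) := multipliable_one_add_of_summable hs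
  have hg : |∏' p, (1 + f p) - 1| ≤ Real.exp (tailBound k y J) - 1 := by
    have h1 := (hs.hasSum)
    have h2 : Tendsto (fun s : Finset Nat.Primes => |∏ p ∈ s, (1 + f p) - 1|) atTop
        (𝓝 |∏' p, (1 + f p) - 1|) := ((hmf.hasProd).sub_const 1).abs
    refine le_of_tendsto h2 (Eventually.of_forall fun s => ?_)
    have h3 := s.norm_prod_one_add_sub_one_le f
    simp only [Real.norm_eq_abs] at h3
    refine h3.trans (sub_le_sub_right (Real.exp_le_exp.2 ?_) 1)
    exact (hs.sum_le_tsum s (fun _ _ => abs_nonneg _)).trans hle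
  have hsplit : singularProd H q = (∏ p ∈ S, singularFactor H p) * ∏' p, (1 + f p) := by
    rw [← hprodu, ← hmu.tprod_mul hmf, singularProd]
    refine tprod_congr fun p => ?_
    simp only [hf, hu, hmemS, tailFactor, add_sub_cancel]
    by_cases h1 : (p : ℕ) ∣ q <;> by_cases h2 : (p : ℕ) ≤ y <;> simp [h1, h2]
  have h0 : 0 ≤ ∏ p ∈ S, singularFactor H p :=
    Finset.prod_nonneg fun p hp => singularFactor_nonneg (Finset.mem_filter.1 hp).2.1 H
  rw [hsplit, ← mul_sub_one, abs_mul, abs_of_nonneg h0]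
  gcongr

/-! ### The mean value of the singular product -/

/-- The truncation parameter, a quarter of the binary logarithm. -/
def truncationPoint (J : ℕ) : ℕ := Nat.log 2 J / 4

theorem tendsto_truncationPoint : Tendsto truncationPoint atTop atTop := by
  refine tendsto_atTop.2 fun b => ?_
  filter_upwards [eventually_ge_atTop (2 ^ (4 * b))] with J hJ
  have : 4 * b ≤ Nat.log 2 J := Nat.le_log_of_pow_le (by norm_num) hJ
  unfold truncationPoint
  omega

/-- The bound y# ≤ 4^y gives (y#)² ≤ 2^(4y), which explains the quarter in the truncation point. -/
theorem prod_primes_sq_le {J : ℕ} (hJ : 0 < J) (S : Finset ℕ)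
    (hS : S ⊆ (Finset.Icc 1 (truncationPoint J)).filter Nat.Prime) : (∏ p ∈ S, p) ^ 2 ≤ J := by
  have h1 : ∏ p ∈ S, p ≤ primorial (truncationPoint J) := by
    rw [primorial]
    refine Finset.prod_le_prod_of_subset_of_one_le' (fun p hp => ?_) fun p hp _ => ?_
    · have := Finset.mem_filter.1 (hS hp)
      have h2 := Finset.mem_Icc.1 this.1
      simp only [Finset.mem_filter, Finset.mem_range]
      exact ⟨by omega, this.2⟩
    · exact (Finset.mem_filter.1 hp).2.one_le
  calc (∏ p ∈ S, p) ^ 2 ≤ (4 ^ truncationPoint J) ^ 2 :=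
        Nat.pow_le_pow_left (h1.trans (primorial_le_four_pow _)) 2
    _ = 2 ^ (4 * truncationPoint J) := by
        rw [← pow_mul, show (4 : ℕ) = 2 ^ 2 by norm_num, ← pow_mul]; congr 1; ring
    _ ≤ 2 ^ Nat.log 2 J := Nat.pow_le_pow_right (by norm_num) (Nat.mul_div_le _ _)
    _ ≤ J := Nat.pow_log_le_self 2 hJ.ne'

/-- With y of order log J, the exceptional primes cost O(log J / (y log y)) = O(1/log y), so y is
large enough for the tail and small enough for the residue count. -/
theorem tendsto_tailBound (k : ℕ) :
    Tendsto (fun J => tailBound k (truncationPoint J) J) atTop (𝓝 0) := by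
  have hy : Tendsto (fun J => (truncationPoint J : ℝ)) atTop atTop :=
    tendsto_natCast_atTop_atTop.comp tendsto_truncationPoint
  have h1 : Tendsto (fun J => (truncationPoint J : ℝ) ^ (-(1 / 2) : ℝ)) atTop (𝓝 0) :=
    (tendsto_rpow_neg_atTop (by norm_num)).comp hy
  have h2 : Tendsto (fun J : ℕ => Real.log J / (truncationPoint J * Real.log (truncationPoint J)))
      atTop (𝓝 0) := by
    have h3 : Tendsto (fun J => 8 / Real.log (truncationPoint J)) atTop (𝓝 0) :=
      (Real.tendsto_log_atTop.comp hy).const_div_atTop 8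
    refine tendsto_of_tendsto_of_tendsto_of_le_of_le' tendsto_const_nhds h3 ?_ ?_
    · refine Eventually.of_forall fun J => ?_
      have := Real.log_natCast_nonneg J
      have := Real.log_natCast_nonneg (truncationPoint J)
      positivity
    · filter_upwards [tendsto_truncationPoint.eventually_ge_atTop 2, eventually_ge_atTop 1]
        with J hJ hJ1
      set y := truncationPoint J with hydef
      have hlt : J < 2 ^ (4 * y + 4) := by
        refine (Nat.lt_pow_succ_log_self (b := 2) (by norm_num) J).trans_le ?_
        refine Nat.pow_le_pow_right (by norm_num) ?_
        simp only [hydef, truncationPoint]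
        omega
      have hlog : Real.log J ≤ 8 * y := by
        have h4 : Real.log J ≤ Real.log ((2 : ℝ) ^ (4 * y + 4)) :=
          Real.log_le_log (by exact_mod_cast hJ1) (by exact_mod_cast hlt.le)
        rw [Real.log_pow] at h4
        have h5 : Real.log 2 ≤ 1 := Real.log_two_lt_d9.le.trans (by norm_num)
        have h6 : (1 : ℝ) ≤ y := by exact_mod_cast (by omega : 1 ≤ y)
        push_cast at h4
        nlinarith
      have hy0 : (0 : ℝ) < y := by exact_mod_cast (by omega : 0 < y)
      have hly : 0 < Real.log y := Real.log_pos (by exact_mod_cast (by omega : 1 < y))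
      rw [div_le_div_iff₀ (by positivity) hly]
      nlinarith
  have h3 := ((h1.mul_const primeZeta).const_mul (2 * (k : ℝ) ^ 2)).add
    ((h2.const_mul ((k : ℝ) ^ 2)).const_mul (2 * (k : ℝ)))
  simp only [zero_mul, mul_zero, add_zero] at h3
  refine h3.congr fun J => ?_
  rw [tailBound]
  ring

theorem exists_sum_singularProd_bounds (k : ℕ) :
    ∃ lo hi : ℕ → ℝ, Tendsto lo atTop (𝓝 (1 / k.factorial)) ∧
      Tendsto hi atTop (𝓝 (1 / k.factorial)) ∧
      ∀ᶠ J : ℕ in atTop, ∀ q : ℕ,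
        lo J * J ^ k ≤ ∑ H ∈ (Finset.Icc 1 J).powersetCard k, singularProd H q ∧
          ∑ H ∈ (Finset.Icc 1 J).powersetCard k, singularProd H q ≤ hi J * J ^ k := by
  have ht : Tendsto (fun J : ℕ => ((k : ℝ) + 1) / √(J : ℝ)) atTop (𝓝 0) :=
    (Real.tendsto_sqrt_atTop.comp tendsto_natCast_atTop_atTop).const_div_atTop _
  have he : Tendsto (fun J => Real.exp (tailBound k (truncationPoint J) J)) atTop (𝓝 1) := by
    have := (Real.continuous_exp.tendsto 0).comp (tendsto_tailBound k)
    rwa [Real.exp_zero] at this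
  refine ⟨fun J => (1 - (k + 1) / √(J : ℝ)) ^ k / k.factorial *
      (2 - Real.exp (tailBound k (truncationPoint J) J)),
    fun J => (1 + (k + 1) / √(J : ℝ)) ^ k / k.factorial *
      Real.exp (tailBound k (truncationPoint J) J), ?_, ?_, ?_⟩
  · have := (((ht.const_sub 1).pow k).div_const (k.factorial : ℝ)).mul (he.const_sub 2)
    convert this using 2
    norm_num
  · have := (((ht.const_add 1).pow k).div_const (k.factorial : ℝ)).mul he
    convert this using 2
    norm_num
  · filter_upwards [eventually_ge_atTop 1, ht.eventually_le_const one_pos,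
      he.eventually_le_const (u := 2) (by norm_num),
      tendsto_truncationPoint.eventually_ge_atTop (2 * k + 2)] with J hJ htJ heJ hyJ q
    set y := truncationPoint J
    set E := Real.exp (tailBound k y J)
    set S := (Finset.Icc 1 y).filter (fun p => p.Prime ∧ ¬ p ∣ q) with hS
    have hSp : ∀ p ∈ S, p.Prime := fun p hp => (Finset.mem_filter.1 hp).2.1
    -- Omitting the primes that divide q only shrinks the modulus. This is why the bounds are
    -- uniform in q.
    have hPJ : (∏ p ∈ S, p) ^ 2 ≤ J := prod_primes_sq_le hJ S fun p hp => by
      have := Finset.mem_filter.1 hp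
      exact Finset.mem_filter.2 ⟨this.1, this.2.1⟩
    obtain ⟨hl, hu⟩ := sum_prod_singularFactor_bounds S hSp hJ hPJ htJ
    have hb : ∀ H ∈ (Finset.Icc 1 J).powersetCard k,
        (∏ p ∈ S, singularFactor H p) * (2 - E) ≤ singularProd H q ∧
          singularProd H q ≤ (∏ p ∈ S, singularFactor H p) * E := by
      intro H hH
      obtain ⟨hH1, hH2⟩ := Finset.mem_powersetCard.1 hH
      have := abs_le.1 (abs_singularProd_sub_le (y := y) q hJ hH1 hH2 (by omega) (by omega))
      constructor <;> linarith
    have h1 := Finset.sum_le_sum fun H hH => (hb H hH).1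
    have h2 := Finset.sum_le_sum fun H hH => (hb H hH).2
    rw [← Finset.sum_mul] at h1 h2
    constructor
    · refine le_trans ?_ h1
      rw [mul_right_comm]
      exact mul_le_mul_of_nonneg_right hl (by linarith)
    · refine h2.trans ?_
      rw [mul_right_comm]
      exact mul_le_mul_of_nonneg_right hu (Real.exp_pos _).le

/-! ### An elementary lower bound for φ(q)/q -/

/-- The primes are enlarged to 2 and all odd n ≥ 3. Since (1 - 1/n)² ≥ (n - 2)/n, the squared
product telescopes over odd n. -/
theorem one_le_prod_primes_sq_mul (m : ℕ) :
    1 ≤ (∏ p ∈ (Finset.Icc 1 (2 * (m + 1))).filter Nat.Prime, (1 - 1 / (p : ℝ))) ^ 2 *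
      (4 * (2 * m + 1)) := by
  induction m with
  | zero =>
    have : (Finset.Icc 1 (2 * (0 + 1))).filter Nat.Prime = {2} := by decide
    rw [this]
    norm_num
  | succ m ih =>
    set A := ∏ p ∈ (Finset.Icc 1 (2 * (m + 1))).filter Nat.Prime, (1 - 1 / (p : ℝ)) with hA
    have hA0 : 0 ≤ A := Finset.prod_nonneg fun p hp =>
      (one_sub_inv_pos_of_prime (Finset.mem_filter.1 hp).2).le
    have hn : (1 - 1 / ((2 * m + 3 : ℕ) : ℝ)) = (2 * m + 2) / (2 * m + 3) := by
      push_cast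
      field_simp
      ring
    have hle : A * (1 - 1 / ((2 * m + 3 : ℕ) : ℝ)) ≤
        ∏ p ∈ (Finset.Icc 1 (2 * (m + 1 + 1))).filter Nat.Prime, (1 - 1 / (p : ℝ)) := by
      have hnot : ¬ Nat.Prime (2 * (m + 1 + 1)) := by
        refine Nat.not_prime_mul (by norm_num) (by omega)
      have hIcc : Finset.Icc 1 (2 * (m + 1 + 1)) =
          insert (2 * (m + 1 + 1)) (insert (2 * m + 3) (Finset.Icc 1 (2 * (m + 1)))) := by
        ext x; simp only [Finset.mem_Icc, Finset.mem_insert]; omega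
      rw [hIcc, Finset.filter_insert, if_neg hnot, Finset.filter_insert]
      split_ifs with hp
      · rw [Finset.prod_insert (by simp only [Finset.mem_filter, Finset.mem_Icc]; omega), mul_comm]
      · refine mul_le_of_le_one_right hA0 ?_
        rw [sub_le_self_iff]; positivity
    have h0 : 0 ≤ A * (1 - 1 / ((2 * m + 3 : ℕ) : ℝ)) := by
      rw [hn]; positivity
    have hsq := pow_le_pow_left₀ h0 hle 2
    refine le_trans ?_ (mul_le_mul_of_nonneg_right hsq (by positivity))
    rw [hn, mul_pow, div_pow]
    refine ih.trans ?_
    push_cast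
    rw [mul_assoc]
    gcongr _ * ?_
    rw [div_mul_eq_mul_div, le_div_iff₀ (by positivity)]
    have : (0 : ℝ) ≤ m := Nat.cast_nonneg m
    nlinarith [mul_nonneg this this, mul_nonneg (mul_nonneg this this) this]

theorem card_primeFactors_le_log (q : ℕ) : q.primeFactors.card ≤ Nat.log 2 q := by
  rcases Nat.eq_zero_or_pos q with rfl | hq
  · simp
  refine Nat.le_log_of_pow_le (by norm_num) ?_
  calc 2 ^ q.primeFactors.card ≤ ∏ p ∈ q.primeFactors, p :=
        Finset.pow_card_le_prod _ _ _ fun p hp => (Nat.prime_of_mem_primeFactors hp).two_le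
    _ ≤ q := Nat.le_of_dvd hq (Nat.prod_primeFactors_dvd q)

/-- With m = ⌊log₂ q⌋, q has at most m prime factors. Those above 2(m + 1) cost at most a factor 1/2
by Bernoulli, and those below are bounded by the product over all primes up to 2(m + 1). -/
theorem le_sqrt_log_mul_totient (q : ℕ) :
    (q : ℝ) ≤ 4 * √(2 * Nat.log 2 q + 1) * q.totient := by
  set m := Nat.log 2 q with hm
  set y := 2 * (m + 1) with hy
  set f : ℕ → ℝ := fun p => 1 - 1 / (p : ℝ) with hf
  have hfpos : ∀ p : ℕ, p.Prime → 0 < f p := fun p hp => one_sub_inv_pos_of_prime hp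
  have hφ : (q.totient : ℝ) = q * ∏ p ∈ q.primeFactors, f p := by
    have := Nat.totient_eq_mul_prod_factors q
    have := congrArg (fun x : ℚ => (x : ℝ)) this
    push_cast at this
    simpa [hf] using this
  have hsplit := Finset.prod_filter_mul_prod_filter_not q.primeFactors (fun p => p ≤ y) f
  have hA : ∏ p ∈ (Finset.Icc 1 y).filter Nat.Prime, f p ≤
      ∏ p ∈ q.primeFactors.filter (fun p => p ≤ y), f p := by
    have hsub : q.primeFactors.filter (fun p => p ≤ y) ⊆ (Finset.Icc 1 y).filter Nat.Prime := by
      intro p hp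
      obtain ⟨h1, h2⟩ := Finset.mem_filter.1 hp
      have := Nat.prime_of_mem_primeFactors h1
      exact Finset.mem_filter.2 ⟨Finset.mem_Icc.2 ⟨this.one_le, h2⟩, this⟩
    have hpos : ∀ p ∈ (Finset.Icc 1 y).filter Nat.Prime, 0 ≤ f p :=
      fun p hp => (hfpos p (Finset.mem_filter.1 hp).2).le
    rw [← Finset.prod_sdiff hsub]
    refine mul_le_of_le_one_left (Finset.prod_nonneg fun p hp => hpos p (hsub hp)) ?_
    refine Finset.prod_le_one (fun p hp => hpos p (Finset.sdiff_subset hp)) fun p _ => ?_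
    simp only [hf, sub_le_self_iff]
    positivity
  have hB : 1 / 2 ≤ ∏ p ∈ q.primeFactors.filter (fun p => ¬ p ≤ y), f p := by
    have hy0 : (0 : ℝ) < y := by positivity
    have hc : ((q.primeFactors.filter (fun p => ¬ p ≤ y)).card : ℝ) ≤ m := by
      exact_mod_cast (Finset.card_filter_le _ _).trans (card_primeFactors_le_log q)
    have hy1 : (1 : ℝ) / y ≤ 1 := by
      rw [div_le_one hy0]; exact_mod_cast (by omega : 1 ≤ y)
    calc (1 : ℝ) / 2 ≤ 1 + (q.primeFactors.filter (fun p => ¬ p ≤ y)).card * (-(1 / y)) := by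
          have : (q.primeFactors.filter (fun p => ¬ p ≤ y)).card * (1 / (y : ℝ)) ≤ 1 / 2 := by
            rw [mul_one_div, div_le_iff₀ hy0, hy]
            push_cast
            linarith
          linarith
      _ ≤ (1 + -(1 / (y : ℝ))) ^ (q.primeFactors.filter (fun p => ¬ p ≤ y)).card :=
          one_add_mul_le_pow (by linarith) _
      _ = ∏ p ∈ q.primeFactors.filter (fun p => ¬ p ≤ y), (1 + -(1 / (y : ℝ))) := by
          rw [Finset.prod_const]
      _ ≤ _ := by
          refine Finset.prod_le_prod (fun p _ => by linarith) fun p hp => ?_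
          have : (y : ℝ) ≤ p := by
            exact_mod_cast (not_le.1 (Finset.mem_filter.1 hp).2).le
          simp only [hf, ← sub_eq_add_neg]
          gcongr
  have hA2 := one_le_prod_primes_sq_mul m
  set A := ∏ p ∈ (Finset.Icc 1 y).filter Nat.Prime, f p with hAdef
  have hA0 : 0 ≤ A := Finset.prod_nonneg fun p hp => (hfpos p (Finset.mem_filter.1 hp).2).le
  have hA3 : 1 ≤ A * (2 * √(2 * (m : ℝ) + 1)) := by
    rw [← one_le_sq_iff₀ (by positivity), mul_pow, mul_pow, Real.sq_sqrt (by positivity)]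
    refine hA2.trans (le_of_eq ?_)
    ring
  rw [hφ, ← hsplit]
  set s := √(2 * (m : ℝ) + 1)
  have hs0 : 0 ≤ s := Real.sqrt_nonneg _
  have h1 : A * (1 / 2) ≤ (∏ p ∈ q.primeFactors.filter (fun p => p ≤ y), f p) *
      ∏ p ∈ q.primeFactors.filter (fun p => ¬ p ≤ y), f p := by
    gcongr
    exact hA0.trans hA
  calc (q : ℝ) ≤ q * (A * (2 * s)) := le_mul_of_one_le_right (Nat.cast_nonneg q) hA3
    _ = 4 * s * (q * (A * (1 / 2))) := by ring
    _ ≤ _ := by gcongr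

/-! ### From factorial moments to the Poisson law -/

/-- A Bonferroni inequality: truncated inclusion–exclusion errs by at most its last term. After
C(k+s, k) C(Y, k+s) = C(Y, k) C(Y-k, s), this is the closed form ±C(m, S) of an alternating partial
sum of the C(m+1, s). -/
theorem abs_indicator_sub_alternating_sum_le (Y k S : ℕ) :
    |(if Y = k then (1 : ℝ) else 0) -
        ∑ s ∈ Finset.range (S + 1), (-1) ^ s * ((k + s).choose k * Y.choose (k + s) : ℝ)| ≤
      (k + S).choose k * Y.choose (k + S) := by
  rcases lt_or_ge Y k with hlt | hge
  · have h0 : ∀ s, Y.choose (k + s) = 0 := fun s => Nat.choose_eq_zero_of_lt (by omega)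
    simp [h0, hlt.ne]
  have hmul : ∀ s, ((k + s).choose k * Y.choose (k + s) : ℝ) = Y.choose k * (Y - k).choose s := by
    intro s
    have := Nat.choose_mul (n := Y) (Nat.le_add_right k s)
    rw [Nat.add_sub_cancel_left, mul_comm] at this
    exact_mod_cast this
  simp_rw [hmul]
  obtain ⟨m, rfl⟩ := Nat.exists_eq_add_of_le hge
  simp only [Nat.add_sub_cancel_left]
  have hfac : ∑ s ∈ Finset.range (S + 1), (-1 : ℝ) ^ s * ((k + m).choose k * m.choose s) =
      (k + m).choose k * ∑ s ∈ Finset.range (S + 1), (-1 : ℝ) ^ s * m.choose s := by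
    rw [Finset.mul_sum]
    exact Finset.sum_congr rfl fun s _ => by ring
  rw [hfac]
  rcases m with _ | m
  · rw [Finset.sum_range_succ', Finset.sum_eq_zero (by simp)]
    simp
  · have := congrArg (fun x : ℤ => (x : ℝ)) (Int.alternating_sum_range_choose_eq_choose (n := m) (m := S))
    push_cast at this
    rw [this, if_neg (by omega), zero_sub, abs_neg, abs_mul, abs_mul, abs_pow, abs_neg, abs_one,
      one_pow, one_mul, Nat.abs_cast, Nat.abs_cast]
    gcongr
    omega

/-- Convergence of all factorial moments to those of a Poisson law implies convergence of the
point probabilities. -/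
theorem tendsto_poisson_of_factorial_moments {ι : Type*} {l : Filter ι} {T : ι → Finset ℕ}
    {Y : ι → ℕ → ℕ} {w : ι → ℝ} (hw : ∀ j, 0 ≤ w j) {lam : ℝ}
    (hmom : ∀ r : ℕ, Tendsto (fun j => (∑ a ∈ T j, ((Y j a).choose r : ℝ)) / w j) l
      (𝓝 (lam ^ r / r.factorial))) (k : ℕ) :
    Tendsto (fun j => (((T j).filter (fun a => Y j a = k)).card : ℝ) / w j) l
      (𝓝 (Real.exp (-lam) * lam ^ k / k.factorial)) := by
  set M : ℕ → ι → ℝ := fun r j => (∑ a ∈ T j, ((Y j a).choose r : ℝ)) / w j with hM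
  have hchoose : ∀ s : ℕ, ((k + s).choose k : ℝ) * (lam ^ (k + s) / (k + s).factorial) =
      lam ^ k / k.factorial * (lam ^ s / s.factorial) := by
    intro s
    rw [Nat.cast_add_choose, pow_add]
    have : ((k + s).factorial : ℝ) ≠ 0 := by positivity
    field_simp
  have hbound : ∀ S j, |(((T j).filter (fun a => Y j a = k)).card : ℝ) / w j -
      ∑ s ∈ Finset.range (S + 1), (-1) ^ s * ((k + s).choose k * M (k + s) j)| ≤
      (k + S).choose k * M (k + S) j := by
    intro S j
    have e1 : (((T j).filter (fun a => Y j a = k)).card : ℝ) / w j -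
        ∑ s ∈ Finset.range (S + 1), (-1) ^ s * ((k + s).choose k * M (k + s) j) =
        (∑ a ∈ T j, ((if Y j a = k then (1 : ℝ) else 0) - ∑ s ∈ Finset.range (S + 1),
          (-1) ^ s * ((k + s).choose k * (Y j a).choose (k + s) : ℝ))) / w j := by
      rw [Finset.sum_sub_distrib, Finset.sum_comm, sub_div, Finset.card_filter]
      push_cast
      congr 1
      rw [Finset.sum_div]
      refine Finset.sum_congr rfl fun s _ => ?_
      rw [hM, ← Finset.mul_sum, ← Finset.mul_sum]
      ring
    rw [e1, abs_div, abs_of_nonneg (hw j), hM, ← mul_div_assoc]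
    refine div_le_div_of_nonneg_right ?_ (hw j)
    refine (Finset.abs_sum_le_sum_abs _ _).trans ?_
    rw [Finset.mul_sum]
    exact Finset.sum_le_sum fun a _ => abs_indicator_sub_alternating_sum_le _ _ _
  set g : ℕ → ℝ := fun s => lam ^ k / k.factorial * (lam ^ s / s.factorial) with hg
  have hlim1 : ∀ S, Tendsto (fun j => ∑ s ∈ Finset.range (S + 1),
      (-1) ^ s * ((k + s).choose k * M (k + s) j)) l
      (𝓝 (∑ s ∈ Finset.range (S + 1), (-1) ^ s * g s)) := by
    intro S
    refine tendsto_finsetSum _ fun s _ => ?_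
    simp only [hg]
    rw [← hchoose]
    exact ((hmom (k + s)).const_mul _).const_mul _
  have hlim2 : ∀ S, Tendsto (fun j => ((k + S).choose k : ℝ) * M (k + S) j) l (𝓝 (g S)) := by
    intro S
    simp only [hg]
    rw [← hchoose]
    exact (hmom (k + S)).const_mul _
  have hg0 : Tendsto g atTop (𝓝 0) := by
    have := (FloorSemiring.tendsto_pow_div_factorial_atTop lam).const_mul (lam ^ k / k.factorial)
    rwa [mul_zero] at this
  have hgs : Tendsto (fun S => ∑ s ∈ Finset.range (S + 1), (-1) ^ s * g s) atTop
      (𝓝 (Real.exp (-lam) * lam ^ k / k.factorial)) := by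
    have h1 : HasSum (fun s : ℕ => (-lam) ^ s / s.factorial) (Real.exp (-lam)) := by
      rw [Real.exp_eq_exp_ℝ]
      exact NormedSpace.expSeries_div_hasSum_exp (-lam)
    have h2 := (h1.mul_left (lam ^ k / k.factorial)).tendsto_sum_nat.comp (tendsto_add_atTop_nat 1)
    rw [show Real.exp (-lam) * lam ^ k / k.factorial = lam ^ k / k.factorial * Real.exp (-lam) by
      ring]
    refine h2.congr fun S => ?_
    refine Finset.sum_congr rfl fun s _ => ?_
    rw [hg, neg_pow]
    ring
  rw [Metric.tendsto_nhds]
  intro ε hε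
  -- The depth S is fixed before j grows, so only finitely many moments are used. Three errors of
  -- ε/4 then arise: the Bonferroni remainder, the moments, and the tail of the exponential series.
  obtain ⟨S, hS1, hS2⟩ := ((hg0.eventually_lt_const (half_pos (half_pos hε))).and
    ((Metric.tendsto_nhds.1 hgs) (ε / 4) (by linarith))).exists
  filter_upwards [(hlim2 S).eventually_lt_const hS1,
    (Metric.tendsto_nhds.1 (hlim1 S)) (ε / 4) (by linarith)] with j hj1 hj2
  have hb := hbound S j
  rw [Real.dist_eq] at hS2 hj2 ⊢
  rw [abs_lt] at hS2 hj2 ⊢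
  rw [abs_le] at hb
  constructor <;> linarith [hb.1, hb.2, hS2.1, hS2.2, hj2.1, hj2.2]

/-! ### Prime tuples in progressions and the conjecture -/

theorem card_coprimesUpTo_self (q : ℕ) : (coprimesUpTo q q).card = q.totient := by
  rw [← Nat.filter_coprime_Ico_eq_totient q 1, coprimesUpTo]
  congr 1
  ext n
  simp only [Finset.mem_filter, Finset.mem_Icc, Finset.mem_Ico, Nat.coprime_comm]
  exact and_congr_left fun _ => by omega

/-- Multiplication by q permutes the residues modulo p. -/
theorem residueCount_image_mul {H : Finset ℕ} {p q : ℕ} (hp : p.Prime) (hpq : ¬ p ∣ q) :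
    residueCount (H.image (fun h => q * h)) p = residueCount H p := by
  unfold residueCount
  rw [Finset.image_image]
  have : (H.image ((fun d => d % p) ∘ fun h => q * h)) =
      (H.image (fun d => d % p)).image (fun r => q * r % p) := by
    rw [Finset.image_image]
    refine Finset.image_congr fun h _ => ?_
    simp [Nat.mul_mod]
  rw [this, Finset.card_image_of_injOn]
  intro r hr s hs hrs
  simp only [Finset.coe_image, Set.mem_image] at hr hs
  obtain ⟨x, -, rfl⟩ := hr
  obtain ⟨y, -, rfl⟩ := hs
  have hco : Nat.gcd p q = 1 := (hp.coprime_iff_not_dvd).2 hpq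
  have := Nat.ModEq.cancel_left_of_coprime hco hrs
  simpa [Nat.ModEq] using this

theorem singularSeries_image_mul {H : Finset ℕ} {q : ℕ} (hq : 0 < q) :
    singularSeries (H.image (fun h => q * h)) q =
      ((q : ℝ) / q.totient) ^ H.card * singularProd H q := by
  have hcard : (H.image (fun h => q * h)).card = H.card :=
    Finset.card_image_of_injective _ fun a b hab => Nat.eq_of_mul_eq_mul_left hq hab
  rw [singularSeries, hcard, ← inv_pow, inv_div, singularProd]
  congr 1
  refine tprod_congr fun p => ?_
  split_ifs with h
  · rfl
  · rw [singularFactor, singularFactor, hcard, residueCount_image_mul p.2 h]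

/-- The number of `1 ≤ h ≤ J` such that `a + q * h` is prime. -/
def shiftedPrimeCount (q J a : ℕ) : ℕ :=
  ((Finset.Icc 1 J).filter (fun h => (a + q * h).Prime)).card

/-- The von Mangoldt weighted count of `r`-tuples of primes in progressions modulo `q`. -/
noncomputable def tupleSum (q J r : ℕ) : ℝ :=
  ∑ H ∈ (Finset.Icc 1 J).powersetCard r, ∑ a ∈ coprimesUpTo q q,
    ∏ h ∈ H, ArithmeticFunction.vonMangoldt (a + q * h)

theorem card_powersetCard_Icc_le (J r : ℕ) :
    (((Finset.Icc 1 J).powersetCard r).card : ℝ) ≤ (J : ℝ) ^ r := by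
  rw [Finset.card_powersetCard, Nat.card_Icc, Nat.add_sub_cancel]
  exact_mod_cast Nat.choose_le_pow J r

theorem sum_choose_shiftedPrimeCount (q J r : ℕ) :
    ∑ a ∈ coprimesUpTo q q, ((shiftedPrimeCount q J a).choose r : ℝ) =
      ∑ H ∈ (Finset.Icc 1 J).powersetCard r, ∑ a ∈ coprimesUpTo q q,
        if ∀ h ∈ H, (a + q * h).Prime then (1 : ℝ) else 0 := by
  have := sum_powersetCard_card_filter r (Finset.Icc 1 J) (coprimesUpTo q q)
    (fun a h => (a + q * h).Prime)
  unfold shiftedPrimeCount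
  rw [← Nat.cast_sum, ← this]
  push_cast [Finset.card_filter]
  rfl

/-- As h ≥ 1, every prime a + qh is at least q and has weight at least log q. Starting the shifts at
h = 1 is what makes this possible. -/
theorem log_pow_mul_sum_choose_le {q : ℕ} (hq : 0 < q) (J r : ℕ) :
    Real.log q ^ r * ∑ a ∈ coprimesUpTo q q, ((shiftedPrimeCount q J a).choose r : ℝ) ≤
      tupleSum q J r := by
  rw [sum_choose_shiftedPrimeCount, Finset.mul_sum, tupleSum]
  refine Finset.sum_le_sum fun H hH => ?_
  obtain ⟨hH1, hH2⟩ := Finset.mem_powersetCard.1 hH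
  rw [Finset.mul_sum]
  refine Finset.sum_le_sum fun a _ => ?_
  split_ifs with h
  · rw [mul_one, ← hH2, ← Finset.prod_const]
    refine Finset.prod_le_prod (fun _ _ => Real.log_natCast_nonneg q) fun x hx => ?_
    rw [ArithmeticFunction.vonMangoldt_apply_prime (h x hx)]
    refine Real.log_le_log (by exact_mod_cast hq) ?_
    have h1 := (Finset.mem_Icc.1 (hH1 hx)).1
    have : q * 1 ≤ q * x := Nat.mul_le_mul_left q h1
    exact_mod_cast (by omega : q ≤ a + q * x)
  · rw [mul_zero]
    exact Finset.prod_nonneg fun _ _ => ArithmeticFunction.vonMangoldt_nonneg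

/-- The prime powers up to `X` that are not primes. -/
def properPrimePowers (X : ℕ) : Finset ℕ :=
  (Finset.Icc 1 X).filter (fun m => IsPrimePow m ∧ ¬ m.Prime)

/-- Each proper prime power contributes at least log 2 to ψ(X) - θ(X). -/
theorem card_properPrimePowers_le {X : ℕ} (hX : 1 ≤ X) :
    ((properPrimePowers X).card : ℝ) ≤ 2 * √(X : ℝ) * Real.log X / Real.log 2 := by
  have hlog2 : 0 < Real.log 2 := Real.log_pos (by norm_num)
  rw [le_div_iff₀ hlog2]
  refine le_trans ?_ (Chebyshev.psi_sub_theta_le (x := X) (by exact_mod_cast hX))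
  rw [Chebyshev.psi_sub_theta_eq_sum_not_prime, ← nsmul_eq_mul]
  refine le_trans (Finset.card_nsmul_le_sum _ ArithmeticFunction.vonMangoldt _ ?_)
    (Finset.sum_le_sum_of_subset_of_nonneg ?_ ?_)
  · intro m hm
    obtain ⟨-, h1, -⟩ := Finset.mem_filter.1 hm
    rw [ArithmeticFunction.vonMangoldt_apply, if_pos h1]
    refine Real.log_le_log (by norm_num) ?_
    exact_mod_cast (Nat.minFac_prime h1.ne_one).two_le
  · intro m hm
    obtain ⟨h0, h1, h2⟩ := Finset.mem_filter.1 hm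
    have := Finset.mem_Icc.1 h0
    simp only [Nat.floor_natCast, Finset.mem_filter, Finset.mem_Ioc]
    exact ⟨by omega, h2⟩
  · intro m _ _
    exact ArithmeticFunction.vonMangoldt_nonneg

/-- A nonzero product has weight at most (log X)^r, and either all its entries are prime or some
entry is a proper prime power. For a given h, distinct a give distinct a + qh, so the second case is
counted by the proper prime powers. -/
theorem tupleSum_le {q J X : ℕ} (r : ℕ) (hX : q * (J + 1) ≤ X) :
    tupleSum q J r ≤ Real.log X ^ r *
      (∑ a ∈ coprimesUpTo q q, ((shiftedPrimeCount q J a).choose r : ℝ) +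
        J ^ r * (r * (properPrimePowers X).card)) := by
  classical
  set B := properPrimePowers X with hB
  have hpt : ∀ H ∈ (Finset.Icc 1 J).powersetCard r, ∀ a ∈ coprimesUpTo q q,
      ∏ h ∈ H, ArithmeticFunction.vonMangoldt (a + q * h) ≤ Real.log X ^ r *
        ((if ∀ h ∈ H, (a + q * h).Prime then (1 : ℝ) else 0) +
          ∑ h ∈ H, if a + q * h ∈ B then (1 : ℝ) else 0) := by
    intro H hH a ha
    obtain ⟨hH1, hH2⟩ := Finset.mem_powersetCard.1 hH
    have ha' := Finset.mem_Icc.1 (Finset.mem_filter.1 ha).1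
    have hxX : ∀ x ∈ H, a + q * x ≤ X := by
      intro x hx
      have h1 := (Finset.mem_Icc.1 (hH1 hx)).2
      have : q * x ≤ q * J := Nat.mul_le_mul_left q h1
      rw [mul_add] at hX
      omega
    have hs0 : 0 ≤ ∑ h ∈ H, if a + q * h ∈ B then (1 : ℝ) else 0 :=
      Finset.sum_nonneg fun _ _ => by split_ifs <;> norm_num
    have hL : 0 ≤ Real.log X := Real.log_natCast_nonneg X
    have hle : ∏ h ∈ H, ArithmeticFunction.vonMangoldt (a + q * h) ≤ Real.log X ^ r := by
      rw [← hH2, ← Finset.prod_const]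
      refine Finset.prod_le_prod (fun _ _ => ArithmeticFunction.vonMangoldt_nonneg) fun x hx => ?_
      refine ArithmeticFunction.vonMangoldt_le_log.trans
        (Real.log_le_log ?_ (by exact_mod_cast hxX x hx))
      exact_mod_cast (by omega : 0 < a + q * x)
    split_ifs with h
    · exact hle.trans (le_mul_of_one_le_right (by positivity) (by linarith))
    · push Not at h
      obtain ⟨x, hx, hxp⟩ := h
      by_cases hpp : IsPrimePow (a + q * x)
      · have hmem : a + q * x ∈ B := Finset.mem_filter.2
          ⟨Finset.mem_Icc.2 ⟨by omega, hxX x hx⟩, hpp, hxp⟩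
        have h1 : (1 : ℝ) ≤ ∑ h ∈ H, if a + q * h ∈ B then (1 : ℝ) else 0 := by
          have := Finset.single_le_sum (f := fun h => if a + q * h ∈ B then (1 : ℝ) else 0)
            (fun _ _ => by split_ifs <;> norm_num) hx
          simpa [hmem] using this
        exact hle.trans (le_mul_of_one_le_right (by positivity) (by linarith))
      · have h0 : ArithmeticFunction.vonMangoldt (a + q * x) = 0 :=
          ArithmeticFunction.vonMangoldt_eq_zero_iff.2 hpp
        rw [Finset.prod_eq_zero hx h0]
        positivity
  have hcount : ∀ h, ∑ a ∈ coprimesUpTo q q, (if a + q * h ∈ B then (1 : ℝ) else 0) ≤ B.card := by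
    intro h
    rw [← Finset.sum_filter, Finset.sum_const, nsmul_eq_mul, mul_one]
    exact_mod_cast Finset.card_le_card_of_injOn (fun a => a + q * h)
      (fun a ha => (Finset.mem_filter.1 ha).2) (fun a _ b _ hab => by simpa using hab)
  have hsum : ∑ H ∈ (Finset.Icc 1 J).powersetCard r, ∑ a ∈ coprimesUpTo q q,
      ∑ h ∈ H, (if a + q * h ∈ B then (1 : ℝ) else 0) ≤ J ^ r * (r * B.card) := by
    calc _ ≤ ∑ H ∈ (Finset.Icc 1 J).powersetCard r, (r * B.card : ℝ) := by
          refine Finset.sum_le_sum fun H hH => ?_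
          rw [Finset.sum_comm, ← (Finset.mem_powersetCard.1 hH).2, ← nsmul_eq_mul]
          exact Finset.sum_le_card_nsmul _ _ _ fun h _ => hcount h
      _ ≤ _ := by
          rw [Finset.sum_const, nsmul_eq_mul]
          exact mul_le_mul_of_nonneg_right (card_powersetCard_Icc_le J r) (by positivity)
  have hL : 0 ≤ Real.log X ^ r := pow_nonneg (Real.log_natCast_nonneg X) r
  calc tupleSum q J r ≤ _ := Finset.sum_le_sum fun H hH => Finset.sum_le_sum fun a ha => hpt H hH a ha
    _ = Real.log X ^ r * (∑ a ∈ coprimesUpTo q q, ((shiftedPrimeCount q J a).choose r : ℝ) +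
        ∑ H ∈ (Finset.Icc 1 J).powersetCard r, ∑ a ∈ coprimesUpTo q q,
          ∑ h ∈ H, (if a + q * h ∈ B then (1 : ℝ) else 0)) := by
        simp_rw [← Finset.mul_sum, Finset.sum_add_distrib]
        rw [sum_choose_shiftedPrimeCount]
    _ ≤ _ := by gcongr

theorem exists_abs_tupleSum_sub_le (hconj : UniformPrimeTupleConjecture) :
    ∃ δ : ℝ, 0 < δ ∧ δ < 1 ∧ ∀ r : ℕ, 1 ≤ r → ∃ C : ℝ, 0 ≤ C ∧ ∀ q J X : ℕ, 1 ≤ q → 1 ≤ J →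
      q * (J + 1) ≤ X →
      |tupleSum q J r - ((q : ℝ) / q.totient) ^ r * q.totient *
          ∑ H ∈ (Finset.Icc 1 J).powersetCard r, singularProd H q| ≤
        J ^ r * (C * (X : ℝ) ^ (1 - δ)) := by
  obtain ⟨δ, hδ0, hδ1, hC⟩ := hconj
  refine ⟨δ, hδ0, by linarith, fun r hr => ?_⟩
  obtain ⟨C, hC⟩ := hC r hr
  refine ⟨|C|, abs_nonneg C, fun q J X hq hJ hX => ?_⟩
  have hinj : Function.Injective (fun h : ℕ => q * h) :=
    fun a b hab => Nat.eq_of_mul_eq_mul_left hq hab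
  have hH : ∀ H ∈ (Finset.Icc 1 J).powersetCard r,
      |∑ a ∈ coprimesUpTo q q, ∏ h ∈ H, ArithmeticFunction.vonMangoldt (a + q * h) -
        ((q : ℝ) / q.totient) ^ r * q.totient * singularProd H q| ≤ |C| * (X : ℝ) ^ (1 - δ) := by
    intro H hH
    obtain ⟨hH1, hH2⟩ := Finset.mem_powersetCard.1 hH
    -- The conjecture is used with N = q, D = qJ and 𝒟 = qH, so that n runs over one reduced residue
    -- system.
    have h1 := hC q q (q * J) hq hq (Nat.mul_pos hq hJ) (H.image (fun h => q * h)) ?_ ?_ ?_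
    · rw [singularSeries_image_mul hq, hH2, card_coprimesUpTo_self] at h1
      simp_rw [Finset.prod_image hinj.injOn] at h1
      rw [mul_right_comm]
      refine h1.trans ((mul_le_mul_of_nonneg_right (le_abs_self C) (by positivity)).trans ?_)
      refine mul_le_mul_of_nonneg_left ?_ (abs_nonneg C)
      refine Real.rpow_le_rpow (by positivity) ?_ (by linarith)
      rw [mul_add] at hX
      exact_mod_cast (by omega : q + q * J ≤ X)
    · intro d hd
      obtain ⟨h, hh, rfl⟩ := Finset.mem_image.1 hd
      obtain ⟨h2, h3⟩ := Finset.mem_Icc.1 (hH1 hh)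
      exact Finset.mem_Icc.2 ⟨Nat.mul_pos hq h2, Nat.mul_le_mul_left q h3⟩
    · rw [Finset.card_image_of_injective _ hinj, hH2]
    · intro d hd
      obtain ⟨h, hh, rfl⟩ := Finset.mem_image.1 hd
      exact dvd_mul_right q h
  rw [tupleSum, Finset.mul_sum, ← Finset.sum_sub_distrib]
  refine (Finset.abs_sum_le_sum_abs _ _).trans ((Finset.sum_le_sum hH).trans ?_)
  rw [Finset.sum_const, nsmul_eq_mul]
  exact mul_le_mul_of_nonneg_right (card_powersetCard_Icc_le J r) (by positivity)

/-! ### Growth rates -/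

section growth

variable {ι : Type*} {l : Filter ι} {lam : ℝ} {M f : ι → ℝ}

theorem tendsto_main_div_of_equivalent (hlam : 0 < lam) (hM : Tendsto M l atTop)
    (hf : f ~[l] fun j => M j / (lam * Real.log (M j))) :
    Tendsto (fun j => M j / (f j * Real.log (M j))) l (𝓝 lam) := by
  have hlog : Tendsto (fun j => Real.log (M j)) l atTop := Real.tendsto_log_atTop.comp hM
  have hne : ∀ᶠ j in l, M j / (lam * Real.log (M j)) ≠ 0 := by
    filter_upwards [hM.eventually_gt_atTop 0, hlog.eventually_gt_atTop 0] with j h1 h2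
    positivity
  have h1 := (((isEquivalent_iff_tendsto_one hne).1 hf).inv₀ one_ne_zero).const_mul lam
  rw [inv_one, mul_one] at h1
  refine h1.congr' ?_
  filter_upwards [hM.eventually_gt_atTop 0, hlog.eventually_gt_atTop 0] with j h2 h3
  simp only [Pi.div_apply]
  field_simp

theorem eventually_pos_of_tendsto (hlam : 0 < lam) (hM : Tendsto M l atTop)
    (h : Tendsto (fun j => M j / (f j * Real.log (M j))) l (𝓝 lam)) : ∀ᶠ j in l, 0 < f j := by
  have hlog : Tendsto (fun j => Real.log (M j)) l atTop := Real.tendsto_log_atTop.comp hM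
  filter_upwards [hM.eventually_gt_atTop 0, hlog.eventually_gt_atTop 0,
    h.eventually_const_lt hlam] with j h1 h2 h3
  have h4 := (div_pos_iff_of_pos_left h1).1 h3
  exact pos_of_mul_pos_left h4 h2.le

theorem tendsto_div_of_isLittleO (hlam : 0 < lam) (hM : Tendsto M l atTop)
    (h : Tendsto (fun j => M j / (f j * Real.log (M j))) l (𝓝 lam)) {g : ℝ → ℝ}
    (hg : Tendsto (fun x => g x * Real.log x / x) atTop (𝓝 0)) :
    Tendsto (fun j => g (M j) / f j) l (𝓝 0) := by
  have hlog : Tendsto (fun j => Real.log (M j)) l atTop := Real.tendsto_log_atTop.comp hM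
  have h1 := (hg.comp hM).mul h
  rw [zero_mul] at h1
  refine h1.congr' ?_
  filter_upwards [hM.eventually_gt_atTop 0, hlog.eventually_gt_atTop 0,
    eventually_pos_of_tendsto hlam hM h] with j h2 h3 h4
  simp only [Function.comp]
  field_simp

theorem tendsto_log_div_log (hlam : 0 < lam) (hM : Tendsto M l atTop)
    (h : Tendsto (fun j => M j / (f j * Real.log (M j))) l (𝓝 lam)) :
    Tendsto (fun j => Real.log (f j) / Real.log (M j)) l (𝓝 1) := by
  have hlog : Tendsto (fun j => Real.log (M j)) l atTop := Real.tendsto_log_atTop.comp hM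
  have h1 : Tendsto (fun j => Real.log (M j / (f j * Real.log (M j))) / Real.log (M j)) l (𝓝 0) :=
    ((Real.continuousAt_log hlam.ne').tendsto.comp h).div_atTop hlog
  have h2 : Tendsto (fun j => Real.log (Real.log (M j)) / Real.log (M j)) l (𝓝 0) :=
    (Real.isLittleO_log_id_atTop.tendsto_div_nhds_zero).comp hlog
  have h3 := (h1.const_sub 1).sub h2
  simp only [sub_zero] at h3
  refine h3.congr' ?_
  filter_upwards [hM.eventually_gt_atTop 0, hlog.eventually_gt_atTop 0,
    eventually_pos_of_tendsto hlam hM h] with j h4 h5 h6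
  rw [Real.log_div h4.ne' (by positivity), Real.log_mul h6.ne' h5.ne']
  field_simp
  ring

end growth

theorem tendsto_log_two_mul_div_log :
    Tendsto (fun x => Real.log (2 * x) / Real.log x) atTop (𝓝 1) := by
  have h := (Real.tendsto_log_atTop.const_div_atTop (Real.log 2)).add_const 1
  rw [zero_add] at h
  refine h.congr' ?_
  filter_upwards [eventually_gt_atTop 1] with x hx
  have := Real.log_pos hx
  rw [Real.log_mul (by norm_num) (by linarith)]
  field_simp

theorem tendsto_rpow_mul_log_div {δ : ℝ} (hδ : 0 < δ) :
    Tendsto (fun x : ℝ => (2 * x) ^ (1 - δ) * Real.log x / x) atTop (𝓝 0) := by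
  have h := ((isLittleO_log_rpow_atTop hδ).tendsto_div_nhds_zero).const_mul ((2 : ℝ) ^ (1 - δ))
  rw [mul_zero] at h
  refine h.congr' ?_
  filter_upwards [eventually_gt_atTop 0] with x hx
  rw [Real.mul_rpow (by norm_num) hx.le, Real.rpow_sub hx, Real.rpow_one]
  field_simp

theorem tendsto_sqrt_mul_log_pow_div (r : ℕ) :
    Tendsto (fun x : ℝ => (Real.log x ^ r * (2 * √(2 * x) * Real.log (2 * x) / Real.log 2)) *
      Real.log x / x) atTop (𝓝 0) := by
  have h := ((isLittleO_log_rpow_rpow_atTop ((r : ℝ) + 2)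
    (show (0 : ℝ) < 1 / 2 by norm_num)).tendsto_div_nhds_zero).mul
    (tendsto_log_two_mul_div_log.mul_const (2 * √2 / Real.log 2))
  rw [zero_mul] at h
  refine h.congr' ?_
  filter_upwards [eventually_gt_atTop 1] with x hx
  have hx0 : 0 < x := by linarith
  have hl := Real.log_pos hx
  have h2 : (0 : ℝ) < Real.log 2 := Real.log_pos (by norm_num)
  have hs : 0 < √x := Real.sqrt_pos.2 hx0
  have hxs : x = √x * √x := (Real.mul_self_sqrt hx0.le).symm
  rw [← Real.sqrt_eq_rpow, Real.sqrt_mul (by norm_num), show (r : ℝ) + 2 = ((r + 2 : ℕ) : ℝ) by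
    push_cast; ring, Real.rpow_natCast, pow_add]
  have e : ∀ z : ℝ, z / x = z / (√x * √x) := fun z => by rw [← hxs]
  rw [e]
  field_simp

/-! ### The limit of the factorial moments -/

/-- The weighted sum has the right limit after division by φ(q)(log M)^r. The count is then squeezed
between versions with weights log 2M and log φ(q), both asymptotic to log M. Leaving J free allows
the use of both ⌊M/q⌋ and ⌊M/q⌋ - 1. -/
theorem tendsto_moment (hconj : UniformPrimeTupleConjecture) {lam : ℝ} (hlam : 0 < lam)
    {M q J : ℕ → ℕ} (hM : Tendsto M atTop atTop)
    (hφ : Tendsto (fun j => (M j : ℝ) / (((q j).totient : ℝ) * Real.log (M j))) atTop (𝓝 lam))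
    (hJ : Tendsto J atTop atTop)
    (hJM : Tendsto (fun j => ((q j * J j : ℕ) : ℝ) / (((q j).totient : ℝ) * Real.log (M j)))
      atTop (𝓝 lam))
    (hqJ : ∀ j, q j * J j ≤ M j) (r : ℕ) :
    Tendsto (fun j => (∑ a ∈ coprimesUpTo (q j) (q j),
      ((shiftedPrimeCount (q j) (J j) a).choose r : ℝ)) / ((q j).totient : ℝ)) atTop
      (𝓝 (lam ^ r / r.factorial)) := by
  have hM' : Tendsto (fun j => (M j : ℝ)) atTop atTop := tendsto_natCast_atTop_atTop.comp hM
  have hlog : Tendsto (fun j => Real.log (M j)) atTop atTop := Real.tendsto_log_atTop.comp hM'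
  have hφpos := eventually_pos_of_tendsto hlam hM' hφ
  -- The conjecture is assumed only for nonempty sets. The zeroth moment is φ(q) itself.
  rcases Nat.eq_zero_or_pos r with rfl | hr
  · refine tendsto_const_nhds.congr' ?_
    filter_upwards [hφpos] with j hj
    simp [card_coprimesUpTo_self, hj.ne']
  obtain ⟨δ, hδ0, hδ1, hC⟩ := exists_abs_tupleSum_sub_le hconj
  obtain ⟨C, hC0, hC⟩ := hC r hr
  obtain ⟨lo, hi, hlo, hhi, hGal⟩ := exists_sum_singularProd_bounds r
  set φ : ℕ → ℝ := fun j => ((q j).totient : ℝ) with hφdef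
  set ℓ : ℕ → ℝ := fun j => Real.log (M j) with hℓdef
  set A : ℕ → ℝ := fun j => ((q j * J j : ℕ) : ℝ) / (φ j * ℓ j) with hA
  set G : ℕ → ℝ := fun j => ∑ H ∈ (Finset.Icc 1 (J j)).powersetCard r, singularProd H (q j)
    with hG
  set Z : ℕ → ℝ := fun j => ∑ a ∈ coprimesUpTo (q j) (q j),
    ((shiftedPrimeCount (q j) (J j) a).choose r : ℝ) with hZ
  set S : ℕ → ℝ := fun j => tupleSum (q j) (J j) r with hS
  replace hφpos : ∀ᶠ j in atTop, 0 < φ j := hφpos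
  have hJpos : ∀ᶠ j in atTop, (0 : ℝ) < J j := by
    filter_upwards [hJ.eventually_gt_atTop 0] with j hj
    exact_mod_cast hj
  have hℓpos : ∀ᶠ j in atTop, 0 < ℓ j := hlog.eventually_gt_atTop 0
  have hGlim : Tendsto (fun j => G j / (J j : ℝ) ^ r) atTop (𝓝 (1 / r.factorial)) := by
    refine tendsto_of_tendsto_of_tendsto_of_le_of_le' (hlo.comp hJ) (hhi.comp hJ) ?_ ?_
    · filter_upwards [hJ.eventually hGal, hJpos] with j h1 h2
      rw [le_div_iff₀ (by positivity)]
      exact (h1 (q j)).1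
    · filter_upwards [hJ.eventually hGal, hJpos] with j h1 h2
      rw [div_le_iff₀ (by positivity)]
      exact (h1 (q j)).2
  have hqpos : ∀ᶠ j in atTop, 1 ≤ q j := by
    filter_upwards [hφpos] with j hj
    have : 0 < (q j).totient := Nat.cast_pos.1 hj
    exact Nat.totient_pos.1 this
  have hX : ∀ᶠ j in atTop, q j * (J j + 1) ≤ 2 * M j := by
    filter_upwards [hJ.eventually_ge_atTop 1] with j hj
    have h1 := hqJ j
    have h2 : q j * 1 ≤ q j * J j := Nat.mul_le_mul_left _ hj
    rw [mul_add]
    omega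
  -- Here A ℓ = qJ/φ(q) and A tends to λ, so J = O(log M): the number of sets H costs only a power
  -- of the logarithm.
  have hJA : ∀ᶠ j in atTop, (J j : ℝ) ≤ A j * ℓ j := by
    filter_upwards [hφpos, hℓpos] with j h1 h2
    have h3 : φ j ≤ q j := Nat.cast_le.2 (Nat.totient_le (q j))
    have h4 : A j * ℓ j = q j * J j / φ j := by
      rw [hA]; push_cast; field_simp
    rw [h4, le_div_iff₀ h1, mul_comm]
    gcongr
  have hErr1 : Tendsto (fun j => A j ^ r * (C * ((2 * (M j : ℝ)) ^ (1 - δ) / φ j))) atTop (𝓝 0) := by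
    have := (hJM.pow r).mul ((tendsto_div_of_isLittleO hlam hM' hφ
      (tendsto_rpow_mul_log_div hδ0)).const_mul C)
    simpa using this
  have hSlim : Tendsto (fun j => S j / (φ j * ℓ j ^ r)) atTop (𝓝 (lam ^ r / r.factorial)) := by
    have hmain : Tendsto (fun j => A j ^ r * (G j / (J j : ℝ) ^ r)) atTop
        (𝓝 (lam ^ r / r.factorial)) := by
      have := (hJM.pow r).mul hGlim
      rwa [mul_one_div] at this
    have hdiff : Tendsto (fun j => S j / (φ j * ℓ j ^ r) - A j ^ r * (G j / (J j : ℝ) ^ r)) atTop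
        (𝓝 0) := by
      refine squeeze_zero_norm' ?_ hErr1
      filter_upwards [hφpos, hℓpos, hJpos, hqpos, hX, hJA, hJ.eventually_ge_atTop 1]
        with j h1 h2 h3 h4 h5 h6 h7
      have h8 := hC (q j) (J j) (2 * M j) h4 h7 h5
      have h9 : S j / (φ j * ℓ j ^ r) - A j ^ r * (G j / (J j : ℝ) ^ r) =
          (S j - ((q j : ℝ) / φ j) ^ r * φ j * G j) / (φ j * ℓ j ^ r) := by
        rw [hA]
        push_cast
        rw [div_pow, div_pow, mul_pow, mul_pow]
        field_simp
      rw [Real.norm_eq_abs, h9, abs_div, abs_of_pos (show 0 < φ j * ℓ j ^ r by positivity),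
        div_le_iff₀ (by positivity)]
      refine h8.trans ?_
      calc (J j : ℝ) ^ r * (C * ((2 * M j : ℕ) : ℝ) ^ (1 - δ))
          ≤ (A j * ℓ j) ^ r * (C * ((2 * M j : ℕ) : ℝ) ^ (1 - δ)) := by gcongr
        _ = _ := by
          push_cast
          rw [mul_pow]
          field_simp
    have := hdiff.add hmain
    simpa using this
  have hlogφ := tendsto_log_div_log hlam hM' hφ
  have hupper : Tendsto (fun j => S j / (φ j * ℓ j ^ r) * (Real.log (φ j) / ℓ j)⁻¹ ^ r) atTop
      (𝓝 (lam ^ r / r.factorial)) := by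
    have := hSlim.mul ((hlogφ.inv₀ one_ne_zero).pow r)
    simpa using this
  have hErr2 : Tendsto (fun j => A j ^ r * (r * ((ℓ j ^ r *
      (2 * √(2 * (M j : ℝ)) * Real.log (2 * M j) / Real.log 2)) / φ j))) atTop (𝓝 0) := by
    have := (hJM.pow r).mul ((tendsto_div_of_isLittleO hlam hM' hφ
      (tendsto_sqrt_mul_log_pow_div r)).const_mul (r : ℝ))
    simpa using this
  have hlower : Tendsto (fun j => S j / (φ j * ℓ j ^ r) * (Real.log (2 * M j) / ℓ j)⁻¹ ^ r -
      A j ^ r * (r * ((ℓ j ^ r *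
      (2 * √(2 * (M j : ℝ)) * Real.log (2 * M j) / Real.log 2)) / φ j))) atTop
      (𝓝 (lam ^ r / r.factorial)) := by
    have := (hSlim.mul (((tendsto_log_two_mul_div_log.comp hM').inv₀ one_ne_zero).pow r)).sub hErr2
    simpa using this
  refine tendsto_of_tendsto_of_tendsto_of_le_of_le' hlower hupper ?_ ?_
  · filter_upwards [hφpos, hℓpos, hX, hJA, hM.eventually_ge_atTop 1] with j h1 h2 h3 h4 h5
    have h6 := tupleSum_le r h3
    have h7 : (1 : ℝ) ≤ M j := by exact_mod_cast h5
    have h8 : 0 < Real.log (2 * M j) := Real.log_pos (by linarith)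
    have h9 := card_properPrimePowers_le (X := 2 * M j) (by omega)
    push_cast at h6 h9
    set B := ((properPrimePowers (2 * M j)).card : ℝ)
    set D := 2 * √(2 * (M j : ℝ)) * Real.log (2 * M j) / Real.log 2
    have h10 : S j / (φ j * ℓ j ^ r) * (Real.log (2 * M j) / ℓ j)⁻¹ ^ r =
        S j / Real.log (2 * M j) ^ r / φ j := by
      rw [inv_div, div_pow]
      field_simp
    have h11 : S j / Real.log (2 * M j) ^ r ≤ Z j + J j ^ r * (r * B) := by
      rw [div_le_iff₀ (by positivity), mul_comm]
      exact h6
    have h12 : (J j : ℝ) ^ r * (r * B) ≤ (A j * ℓ j) ^ r * (r * D) := by gcongr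
    have h13 : A j ^ r * (r * ((ℓ j ^ r * D) / φ j)) = (A j * ℓ j) ^ r * (r * D) / φ j := by
      rw [mul_pow]; ring
    rw [h10, h13, ← sub_div]
    gcongr
    linarith
  · filter_upwards [hφpos, hℓpos, hqpos, hlogφ.eventually_const_lt one_pos] with j h1 h2 h3 h4
    have h5 := log_pow_mul_sum_choose_le h3 (J j) r
    have h6 : 0 < Real.log (φ j) := (div_pos_iff_of_pos_right h2).1 h4
    have h7 : Real.log (φ j) ≤ Real.log (q j) :=
      Real.log_le_log h1 (Nat.cast_le.2 (Nat.totient_le (q j)))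
    have h8 : S j / (φ j * ℓ j ^ r) * (Real.log (φ j) / ℓ j)⁻¹ ^ r =
        S j / Real.log (φ j) ^ r / φ j := by
      rw [inv_div, div_pow]
      field_simp
    have h9 : 0 ≤ Z j := Finset.sum_nonneg fun _ _ => Nat.cast_nonneg _
    rw [h8]
    gcongr
    rw [le_div_iff₀ (by positivity), mul_comm]
    refine le_trans ?_ h5
    gcongr

/-! ### The size of q relative to N -/

theorem tendsto_div_totient_mul_log {lam : ℝ} (hlam : 0 < lam) {M q : ℕ → ℕ}
    (hM : Tendsto M atTop atTop)
    (hφ : Tendsto (fun j => (M j : ℝ) / (((q j).totient : ℝ) * Real.log (M j))) atTop (𝓝 lam)) :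
    Tendsto (fun j => (q j : ℝ) / (((q j).totient : ℝ) * Real.log (M j))) atTop (𝓝 0) := by
  have hM' : Tendsto (fun j => (M j : ℝ)) atTop atTop := tendsto_natCast_atTop_atTop.comp hM
  have hlog : Tendsto (fun j => Real.log (M j)) atTop atTop := Real.tendsto_log_atTop.comp hM'
  have hlim : Tendsto (fun j => 20 / √(Real.log (M j))) atTop (𝓝 0) :=
    (Real.tendsto_sqrt_atTop.comp hlog).const_div_atTop 20
  refine squeeze_zero' ?_ ?_ hlim
  · filter_upwards [hlog.eventually_gt_atTop 0] with j hj
    positivity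
  filter_upwards [hlog.eventually_ge_atTop (Real.log 48 + 1),
    eventually_pos_of_tendsto hlam hM' hφ,
    (tendsto_log_div_log hlam hM' hφ).eventually_le_const (u := 2) (by norm_num)] with j h1 h2 h3
  set ℓ := Real.log (M j)
  set φ : ℝ := ((q j).totient : ℝ)
  set n := Nat.log 2 (q j) with hn
  have hℓ : 1 ≤ ℓ := by
    have := Real.log_nonneg (show (1 : ℝ) ≤ 48 by norm_num)
    linarith
  have hq : 0 < q j := Nat.totient_pos.1 (Nat.cast_pos.1 h2)
  have hq' : (0 : ℝ) < q j := by exact_mod_cast hq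
  have hbound : (q j : ℝ) ≤ 4 * √(2 * n + 1) * φ := le_sqrt_log_mul_totient (q j)
  have hpow : 2 ^ n ≤ q j := Nat.pow_log_le_self 2 hq.ne'
  have hnq : (2 * n + 1 : ℝ) ≤ 3 * q j := by
    have := (Nat.lt_two_pow_self (n := n)).le
    exact_mod_cast (by omega : 2 * n + 1 ≤ 3 * q j)
  -- A crude first use of the totient bound, with 2n + 1 ≤ 3q, gives log q = O(log M). Hence n =
  -- O(log M), and the same bound used again gives q/φ(q) = O(√log M).
  have hq48 : (q j : ℝ) ≤ 48 * φ ^ 2 := by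
    have := pow_le_pow_left₀ hq'.le hbound 2
    rw [mul_pow, mul_pow, Real.sq_sqrt (by positivity)] at this
    have h4 : (q j : ℝ) * q j ≤ (48 * φ ^ 2) * q j := by nlinarith [sq_nonneg φ]
    exact le_of_mul_le_mul_right h4 hq'
  have hlogq : Real.log (q j) ≤ Real.log 48 + 2 * Real.log φ := by
    have := Real.log_le_log hq' hq48
    rwa [Real.log_mul (by norm_num) (by positivity), Real.log_pow, Nat.cast_ofNat] at this
  have hn10 : (n : ℝ) ≤ 10 * ℓ := by
    have h5 : n * Real.log 2 ≤ Real.log (q j) := by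
      rw [← Real.log_pow]
      exact Real.log_le_log (by positivity) (by exact_mod_cast hpow)
    have h6 : (1 / 2 : ℝ) ≤ Real.log 2 := by linarith [Real.log_two_gt_d9]
    rw [div_le_iff₀ (by linarith)] at h3
    have h7 : (n : ℝ) * (1 / 2) ≤ n * Real.log 2 := by gcongr
    linarith
  have hsqrt : √(2 * (n : ℝ) + 1) ≤ 5 * √ℓ := by
    rw [Real.sqrt_le_left (by positivity), mul_pow, Real.sq_sqrt (by linarith)]
    linarith
  have hs : 0 < √ℓ := Real.sqrt_pos.2 (by linarith)
  have hss : √ℓ * √ℓ = ℓ := Real.mul_self_sqrt (by linarith)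
  rw [div_le_div_iff₀ (by positivity) hs]
  calc (q j : ℝ) * √ℓ ≤ (4 * √(2 * n + 1) * φ) * √ℓ := by gcongr
    _ ≤ (4 * (5 * √ℓ) * φ) * √ℓ := by gcongr
    _ = 20 * (φ * (√ℓ * √ℓ)) := by ring
    _ = 20 * (φ * ℓ) := by rw [hss]

/-- M/q is the quotient of M/(φ(q) log M), which tends to λ > 0, by q/(φ(q) log M), which tends to 0
through positive values. -/
theorem tendsto_natDiv_atTop {lam : ℝ} (hlam : 0 < lam) {M q : ℕ → ℕ}
    (hM : Tendsto M atTop atTop)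
    (hφ : Tendsto (fun j => (M j : ℝ) / (((q j).totient : ℝ) * Real.log (M j))) atTop (𝓝 lam)) :
    Tendsto (fun j => M j / q j) atTop atTop := by
  have hM' : Tendsto (fun j => (M j : ℝ)) atTop atTop := tendsto_natCast_atTop_atTop.comp hM
  have hlog : Tendsto (fun j => Real.log (M j)) atTop atTop := Real.tendsto_log_atTop.comp hM'
  have hev : ∀ᶠ j in atTop, 0 < (q j : ℝ) / (((q j).totient : ℝ) * Real.log (M j)) := by
    filter_upwards [eventually_pos_of_tendsto hlam hM' hφ, hlog.eventually_gt_atTop 0]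
      with j h1 h2
    have hq : 0 < q j := Nat.totient_pos.1 (Nat.cast_pos.1 h1)
    positivity
  have h0 := tendsto_nhdsWithin_iff.2 ⟨tendsto_div_totient_mul_log hlam hM hφ, hev⟩
  have h1 := hφ.pos_mul_atTop hlam (tendsto_inv_nhdsGT_zero.comp h0)
  have h2 := tendsto_nat_floor_atTop.comp h1
  refine h2.congr' ?_
  filter_upwards [eventually_pos_of_tendsto hlam hM' hφ, hlog.eventually_gt_atTop 0] with j h3 h4
  have hq : 0 < q j := Nat.totient_pos.1 (Nat.cast_pos.1 h3)
  have hq' : (0 : ℝ) < q j := by exact_mod_cast hq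
  rw [← Nat.floor_div_eq_div (K := ℝ)]
  simp only [Function.comp]
  congr 1
  field_simp

/-! ### Comparison with π(N; q, a) -/

theorem primeCountAP_eq_shiftedPrimeCount {M q a : ℕ} (haq : a < q) (ha : ¬ a.Prime)
    (hJ : ¬ (a + q * (M / q)).Prime) : primeCountAP M q a = shiftedPrimeCount q (M / q) a := by
  unfold primeCountAP shiftedPrimeCount
  symm
  have hq : 0 < q := by omega
  refine Finset.card_nbij (fun h => a + q * h) ?_ ?_ ?_
  · intro h hh
    simp only [Finset.coe_filter, Finset.mem_Icc, Set.mem_ofPred_eq] at hh ⊢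
    obtain ⟨⟨h1, h2⟩, h3⟩ := hh
    -- Only at the last h can a + qh exceed M; for smaller h it stays below q(h + 1) ≤ M.
    have hne : h ≠ M / q := fun e => hJ (e ▸ h3)
    have h4 : q * (h + 1) ≤ q * (M / q) := Nat.mul_le_mul_left q (by omega)
    have h5 := Nat.mul_div_le M q
    have h6 := h3.one_le
    rw [mul_add] at h4
    refine ⟨⟨h6, by omega⟩, h3, ?_⟩
    simp [Nat.ModEq]
  · intro x _ y _ hxy
    have : q * x = q * y := by simpa using hxy
    exact Nat.eq_of_mul_eq_mul_left hq this
  · intro p hp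
    simp only [Finset.coe_filter, Finset.mem_Icc, Set.mem_ofPred_eq] at hp
    obtain ⟨⟨h1, h2⟩, h3, h4⟩ := hp
    have h5 : p % q = a := by rw [h4, Nat.mod_eq_of_lt haq]
    have h6 : a + q * (p / q) = p := by rw [← h5]; exact Nat.mod_add_div p q
    refine ⟨p / q, ?_, h6⟩
    simp only [Finset.coe_filter, Finset.mem_Icc, Set.mem_ofPred_eq]
    refine ⟨⟨?_, Nat.div_le_div_right h2⟩, by rwa [h6]⟩
    rw [Nat.one_le_iff_ne_zero]
    intro h0
    rw [h0, mul_zero, add_zero] at h6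
    exact ha (h6 ▸ h3)

theorem coprimesUpTo_self {q : ℕ} (hq : 2 ≤ q) :
    coprimesUpTo q q = (Finset.range q).filter (fun a => Nat.Coprime a q) := by
  ext a
  simp only [coprimesUpTo, Finset.mem_filter, Finset.mem_Icc, Finset.mem_range]
  refine and_congr_left fun h => ⟨fun ⟨_, h2⟩ => lt_of_le_of_ne h2 ?_, fun h1 => ⟨?_, h1.le⟩⟩
  · rintro rfl
    rw [Nat.coprime_self] at h
    omega
  · rw [Nat.one_le_iff_ne_zero]
    rintro rfl
    rw [Nat.coprime_zero_left] at h
    omega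

theorem shiftedPrimeCount_succ (q J a : ℕ) :
    shiftedPrimeCount q (J + 1) a =
      shiftedPrimeCount q J a + if (a + q * (J + 1)).Prime then 1 else 0 := by
  unfold shiftedPrimeCount
  rw [← Finset.insert_Icc_right_eq_Icc_add_one (by omega), Finset.filter_insert]
  split_ifs with h
  · rw [Finset.card_insert_of_notMem (by simp)]
  · rfl

/-- The counts agree unless a or a + q⌊M/q⌋ is prime. The number of a of the second kind is the
difference of the first moments for ⌊M/q⌋ and ⌊M/q⌋ - 1, which have the same limit, so no separate
sieve bound is needed. -/
theorem abs_reducedResiduesWithCount_sub_le {M q k : ℕ} (hq : 2 ≤ q) (hJ : 1 ≤ M / q) :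
    |(reducedResiduesWithCount M q k : ℝ) -
        ((coprimesUpTo q q).filter (fun a => shiftedPrimeCount q (M / q) a = k)).card| ≤
      Nat.primeCounting q +
        (∑ a ∈ coprimesUpTo q q, ((shiftedPrimeCount q (M / q) a).choose 1 : ℝ) -
          ∑ a ∈ coprimesUpTo q q, ((shiftedPrimeCount q (M / q - 1) a).choose 1 : ℝ)) := by
  set T := coprimesUpTo q q with hT
  have hTq : ∀ a ∈ T, a < q := by
    intro a ha
    rw [hT, coprimesUpTo_self hq] at ha
    exact Finset.mem_range.1 (Finset.mem_filter.1 ha).1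
  have h1 : reducedResiduesWithCount M q k = (T.filter (fun a => primeCountAP M q a = k)).card := by
    rw [hT, coprimesUpTo_self hq, Finset.filter_filter, reducedResiduesWithCount]
  have h2 : ∑ a ∈ T, ((shiftedPrimeCount q (M / q) a).choose 1 : ℝ) -
      ∑ a ∈ T, ((shiftedPrimeCount q (M / q - 1) a).choose 1 : ℝ) =
      ∑ a ∈ T, if (a + q * (M / q)).Prime then (1 : ℝ) else 0 := by
    rw [← Finset.sum_sub_distrib]
    refine Finset.sum_congr rfl fun a _ => ?_
    obtain ⟨J, hJ'⟩ := Nat.exists_eq_add_of_le' hJ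
    rw [hJ', Nat.add_sub_cancel, shiftedPrimeCount_succ]
    split_ifs <;> simp
  have h3 : ∑ a ∈ T, (if a.Prime then (1 : ℝ) else 0) ≤ Nat.primeCounting q := by
    rw [← Finset.sum_filter, Finset.sum_const, nsmul_eq_mul, mul_one, Nat.primeCounting,
      Nat.primeCounting', Nat.count_eq_card_filter_range]
    refine Nat.cast_le.2 (Finset.card_le_card ?_)
    intro a ha
    obtain ⟨ha, hp⟩ := Finset.mem_filter.1 ha
    exact Finset.mem_filter.2 ⟨Finset.mem_range.2 ((hTq a ha).trans (Nat.lt_succ_self q)), hp⟩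
  rw [h1, h2, Finset.card_filter, Finset.card_filter]
  push_cast
  rw [← Finset.sum_sub_distrib]
  refine (Finset.abs_sum_le_sum_abs _ _).trans ?_
  refine le_trans ?_ (add_le_add_left h3 _)
  rw [← Finset.sum_add_distrib]
  refine Finset.sum_le_sum fun a ha => ?_
  have h01 : |(if primeCountAP M q a = k then (1 : ℝ) else 0) -
      if shiftedPrimeCount q (M / q) a = k then 1 else 0| ≤ 1 := by
    split_ifs <;> norm_num
  by_cases hap : a.Prime
  · rw [if_pos hap]
    refine h01.trans (le_add_of_nonneg_right ?_)
    split_ifs <;> norm_num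
  by_cases haJ : (a + q * (M / q)).Prime
  · rw [if_pos haJ, if_neg hap, zero_add]
    exact h01
  · rw [primeCountAP_eq_shiftedPrimeCount (hTq a ha) hap haJ, if_neg hap, if_neg haJ]
    simp

/-- Chebyshev gives π(q) = O(q/log q). Since log q ≥ log φ(q) ~ log M, the claim reduces to q =
o(φ(q) log M). -/
theorem tendsto_primeCounting_div_totient {lam : ℝ} (hlam : 0 < lam) {M q : ℕ → ℕ}
    (hM : Tendsto M atTop atTop)
    (hφ : Tendsto (fun j => (M j : ℝ) / (((q j).totient : ℝ) * Real.log (M j))) atTop (𝓝 lam))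
    (hq : Tendsto q atTop atTop) :
    Tendsto (fun j => (Nat.primeCounting (q j) : ℝ) / ((q j).totient : ℝ)) atTop (𝓝 0) := by
  have hM' : Tendsto (fun j => (M j : ℝ)) atTop atTop := tendsto_natCast_atTop_atTop.comp hM
  have hlog : Tendsto (fun j => Real.log (M j)) atTop atTop := Real.tendsto_log_atTop.comp hM'
  have hlogφ := tendsto_log_div_log hlam hM' hφ
  have hlim : Tendsto (fun j => (Real.log 4 + 1) * ((q j : ℝ) / (((q j).totient : ℝ) *
      Real.log (M j)) * (Real.log ((q j).totient : ℝ) / Real.log (M j))⁻¹)) atTop (𝓝 0) := by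
    have := ((tendsto_div_totient_mul_log hlam hM hφ).mul (hlogφ.inv₀ one_ne_zero)).const_mul
      (Real.log 4 + 1)
    simpa using this
  refine squeeze_zero' (Eventually.of_forall fun j => by positivity) ?_ hlim
  have hπ := (tendsto_natCast_atTop_atTop.comp hq).eventually
    (Chebyshev.eventually_primeCounting_le (ε := 1) one_pos)
  filter_upwards [hπ, eventually_pos_of_tendsto hlam hM' hφ, hlog.eventually_gt_atTop 0,
    hlogφ.eventually_const_lt one_pos] with j h1 h2 h3 h4
  simp only [Function.comp, Nat.floor_natCast] at h1
  have h5 : 0 < Real.log ((q j).totient : ℝ) := (div_pos_iff_of_pos_right h3).1 h4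
  have h6 : Real.log ((q j).totient : ℝ) ≤ Real.log (q j) :=
    Real.log_le_log h2 (Nat.cast_le.2 (Nat.totient_le (q j)))
  have h7 : 0 < Real.log 4 := Real.log_pos (by norm_num)
  calc (Nat.primeCounting (q j) : ℝ) / ((q j).totient : ℝ)
      ≤ ((Real.log 4 + 1) * (q j : ℝ) / Real.log ((q j).totient : ℝ)) / ((q j).totient : ℝ) := by
        refine div_le_div_of_nonneg_right (h1.trans ?_) h2.le
        gcongr
    _ = _ := by
        rw [inv_div]
        field_simp

theorem tendsto_mul_natDiv_div {lam : ℝ} (hlam : 0 < lam) {M q : ℕ → ℕ}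
    (hM : Tendsto M atTop atTop)
    (hφ : Tendsto (fun j => (M j : ℝ) / (((q j).totient : ℝ) * Real.log (M j))) atTop (𝓝 lam))
    {J : ℕ → ℕ} (hJ1 : ∀ j, J j ≤ M j / q j) (hJ2 : ∀ j, M j / q j ≤ J j + 1) :
    Tendsto (fun j => ((q j * J j : ℕ) : ℝ) / (((q j).totient : ℝ) * Real.log (M j)))
      atTop (𝓝 lam) := by
  have hlow : Tendsto (fun j => (M j : ℝ) / (((q j).totient : ℝ) * Real.log (M j)) -
      2 * ((q j : ℝ) / (((q j).totient : ℝ) * Real.log (M j)))) atTop (𝓝 lam) := by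
    -- One q is lost in rounding M/q down, and at most one more because J may be one less than the
    -- quotient.
    have := hφ.sub ((tendsto_div_totient_mul_log hlam hM hφ).const_mul 2)
    simpa using this
  have hM' : Tendsto (fun j => (M j : ℝ)) atTop atTop := tendsto_natCast_atTop_atTop.comp hM
  refine tendsto_of_tendsto_of_tendsto_of_le_of_le' hlow hφ ?_ ?_
  · filter_upwards [eventually_pos_of_tendsto hlam hM' hφ] with j h1
    have hq : 0 < q j := Nat.totient_pos.1 (Nat.cast_pos.1 h1)
    rw [← mul_div_assoc, ← sub_div]
    have h2 := Real.log_natCast_nonneg (M j)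
    gcongr
    rw [sub_le_iff_le_add]
    have h3 : M j < q j * (M j / q j + 1) := Nat.lt_mul_div_succ (M j) hq
    have h4 : q j * (M j / q j + 1) ≤ q j * (J j + 1 + 1) :=
      Nat.mul_le_mul_left _ (Nat.add_le_add_right (hJ2 j) 1)
    exact_mod_cast (h3.le.trans h4).trans (le_of_eq (by ring))
  · refine Eventually.of_forall fun j => ?_
    have h2 := Real.log_natCast_nonneg (M j)
    gcongr
    exact (Nat.mul_le_mul_left _ (hJ1 j)).trans (Nat.mul_div_le _ _)

/-! ### The Poisson limit -/

theorem corollary1p5 (hconj : UniformPrimeTupleConjecture)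
    (k : ℕ) (lam : ℝ) (hlam : 0 < lam)
    (N q : ℕ → ℕ) (hN : Tendsto N atTop atTop)
    (hq : (fun j : ℕ => (Nat.totient (q j) : ℝ)) ~[atTop]
      (fun j : ℕ => (N j : ℝ) / (lam * Real.log (N j : ℝ)))) :
    Tendsto
      (fun j : ℕ => (reducedResiduesWithCount (N j) (q j) k : ℝ) / (Nat.totient (q j) : ℝ))
      atTop (𝓝 (Real.exp (-lam) * lam ^ k / (Nat.factorial k : ℝ))) := by
  have hN' : Tendsto (fun j => (N j : ℝ)) atTop atTop := tendsto_natCast_atTop_atTop.comp hN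
  have hφ := tendsto_main_div_of_equivalent hlam hN' hq
  have hJ := tendsto_natDiv_atTop hlam hN hφ
  have hqtop : Tendsto q atTop atTop := by
    have h1 : Tendsto (fun j => Real.log ((q j).totient : ℝ)) atTop atTop := by
      have hlog : Tendsto (fun j => Real.log (N j)) atTop atTop := Real.tendsto_log_atTop.comp hN'
      refine ((tendsto_log_div_log hlam hN' hφ).pos_mul_atTop one_pos hlog).congr' ?_
      filter_upwards [hlog.eventually_gt_atTop 0] with j hj
      field_simp
    have h2 : Tendsto (fun j => (q j : ℝ)) atTop atTop := by
      refine tendsto_atTop_mono' _ ?_ h1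
      filter_upwards [eventually_pos_of_tendsto hlam hN' hφ] with j hj
      have h3 := Real.log_le_sub_one_of_pos hj
      have h4 : ((q j).totient : ℝ) ≤ q j := Nat.cast_le.2 (Nat.totient_le (q j))
      linarith
    exact tendsto_natCast_atTop_iff.1 h2
  have hmom := tendsto_moment hconj hlam hN hφ hJ
    (tendsto_mul_natDiv_div hlam hN hφ (fun _ => le_rfl) (fun _ => Nat.le_succ _))
    (fun j => Nat.mul_div_le _ _)
  have hmom' := tendsto_moment hconj hlam hN hφ (J := fun j => N j / q j - 1)
    ((tendsto_sub_atTop_nat 1).comp hJ)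
    (tendsto_mul_natDiv_div hlam hN hφ (fun _ => Nat.sub_le _ _) (fun _ => by omega))
    (fun j => (Nat.mul_le_mul_left _ (Nat.sub_le _ _)).trans (Nat.mul_div_le _ _))
  have hpoi := tendsto_poisson_of_factorial_moments (fun j => Nat.cast_nonneg _) hmom k
  -- The two first moments both tend to λ, so their difference disappears in the limit.
  have herr := (tendsto_primeCounting_div_totient hlam hN hφ hqtop).add
    ((hmom 1).sub (hmom' 1))
  rw [sub_self, add_zero] at herr
  have hdiff : Tendsto (fun j => (reducedResiduesWithCount (N j) (q j) k : ℝ) /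
      ((q j).totient : ℝ) - (((coprimesUpTo (q j) (q j)).filter
        (fun a => shiftedPrimeCount (q j) (N j / q j) a = k)).card : ℝ) / ((q j).totient : ℝ))
      atTop (𝓝 0) := by
    refine squeeze_zero_norm' ?_ herr
    filter_upwards [hqtop.eventually_ge_atTop 2, hJ.eventually_ge_atTop 1] with j h1 h2
    rw [← sub_div, ← sub_div, ← add_div, Real.norm_eq_abs, abs_div, Nat.abs_cast]
    exact div_le_div_of_nonneg_right (abs_reducedResiduesWithCount_sub_le h1 h2)
      (Nat.cast_nonneg _)
  simpa using hdiff.add hpoi
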